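/- A stable plane (of positive dimension) is a pair $(M,\mathcal L)$ consisting of a set $M$ of points and a set $\mathcal L$ of subsets of $M$, called lines, both endowed with locally compact Hausdorff topologies of positive topological dimension, such that: any two distinct points $p,q$ lie on a unique line $p\vee q$; the map $(p,q)\mapsto p\vee q$, defined for $p\neq q$, is continuous; the set of pairs of distinct intersecting lines is open in $\mathcal L\times\mathcal L$, and the map sending such a pair to its point of intersection is continuous; and there are four points no three of which lie on one line. The topological dimension is the small inductive dimension; no upper bound on it is assumed. A stable plane is - semiaffine if for every line $L$ and every point $p\notin L$ there is at most one line through $p$ disjoint from $L$; - an affine plane if for every line $L$ and every point $p\notin L$ there is exactly one line through $p$ disjoint from $L$; - a projective plane if any two lines intersect. A punctured projective plane is a projective plane $(P,\mathcal K)$ with one point $o$ deleted, that is, a pair $(M,\mathcal L)$, with topologies on $M$ and $\mathcal L$, that is isomorphic (through homeomorphisms of the point spaces and of the line spaces that preserve incidence in both directions) to $P\setminus\{o\}$ with the lines $K\setminus\{o\}$, $K\in\mathcal K$, where the point set has the subspace topology and the set of lines has the topology of $\mathcal K$. **Theorem.** The semiaffine stable planes are precisely the affine planes, the projective planes and the punctured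 projective planes. That is, if $M$ is a topological space and $\mathcal L$ is a set of subsets of $M$ that is itself endowed with a topology, then $(M,\mathcal L)$ is a semiaffine stable plane if and only if it is an affine plane, a projective plane or a punctured projective plane. (In particular, punctured projective planes are stable planes.) -/

import Mathlib

universe u

/-- A (locally compact) stable plane of positive topological dimension with point set `M` and set of
lines `𝓛 ⊆ 𝒫(M)`.  Topologies on `M` and on `𝓛` are part of the data.  Locally compact spaces are
understood to be Hausdorff; the topological dimension is the small inductive dimension (a locally
compact Hausdorff space has positive dimension iff it is not totally disconnected). -/
structure IsStablePlane (M : Type u) [TopologicalSpace M]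
    (𝓛 : Set (Set M)) [TopologicalSpace 𝓛] : Prop where
  t2_points : T2Space M
  t2_lines : T2Space 𝓛
  locallyCompact_points : LocallyCompactSpace M
  locallyCompact_lines : LocallyCompactSpace 𝓛
  dim_points_pos : 0 < smallInductiveDimension M
  dim_lines_pos : 0 < smallInductiveDimension 𝓛
  /-- Any two points are joined by a unique line. -/
  existsUnique_join : ∀ p q : M, p ≠ q → ∃! L : 𝓛, p ∈ (L : Set M) ∧ q ∈ (L : Set M)
  /-- Joining (defined on pairs of distinct points) is continuous. -/
  continuous_join : ∃ j : {x : M × M // x.1 ≠ x.2} → 𝓛,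
    (∀ x, x.1.1 ∈ (j x : Set M) ∧ x.1.2 ∈ (j x : Set M)) ∧ Continuous j
  /-- Stability of intersection: the set of pairs of (distinct) intersecting lines is open. -/
  isOpen_intersecting :
    IsOpen {x : 𝓛 × 𝓛 | x.1 ≠ x.2 ∧ ((x.1 : Set M) ∩ (x.2 : Set M)).Nonempty}
  /-- Intersection (defined on pairs of distinct intersecting lines) is continuous. -/
  continuous_meet :
    ∃ m : {x : 𝓛 × 𝓛 // x.1 ≠ x.2 ∧ ((x.1 : Set M) ∩ (x.2 : Set M)).Nonempty} → M,
      (∀ x, m x ∈ (x.1.1 : Set M) ∧ m x ∈ (x.1.2 : Set M)) ∧ Continuous m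
  /-- There is a quadrangle: four points no three of which are on one line. -/
  exists_quadrangle : ∃ a : Fin 4 → M, Function.Injective a ∧
    ∀ i j k : Fin 4, i ≠ j → i ≠ k → j ≠ k →
      ∀ L ∈ 𝓛, ¬ (a i ∈ L ∧ a j ∈ L ∧ a k ∈ L)

/-- A plane is semiaffine if for every line `L` and every point `p ∉ L` there is at most one line
through `p` disjoint from `L`. -/
def IsSemiaffine {M : Type u} (𝓛 : Set (Set M)) : Prop :=
  ∀ L ∈ 𝓛, ∀ p, p ∉ L →
    ∀ K₁ ∈ 𝓛, ∀ K₂ ∈ 𝓛, p ∈ K₁ → p ∈ K₂ → Disjoint K₁ L → Disjoint K₂ L → K₁ = K₂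

/-- An affine plane: a stable plane in which for every line `L` and every point `p ∉ L` there is
exactly one line through `p` disjoint from `L`. -/
structure IsAffinePlane (M : Type u) [TopologicalSpace M]
    (𝓛 : Set (Set M)) [TopologicalSpace 𝓛] : Prop extends IsStablePlane M 𝓛 where
  parallel_axiom : ∀ L ∈ 𝓛, ∀ p, p ∉ L → ∃! K : Set M, K ∈ 𝓛 ∧ p ∈ K ∧ Disjoint K L

/-- A (topological) projective plane: a stable plane in which two lines always intersect. -/
structure IsProjectivePlane (M : Type u) [TopologicalSpace M]
    (𝓛 : Set (Set M)) [TopologicalSpace 𝓛] : Prop extends IsStablePlane M 𝓛 where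
  lines_meet : ∀ K ∈ 𝓛, ∀ L ∈ 𝓛, (K ∩ L).Nonempty

/-- The lines of the plane obtained from `(P, 𝓚)` by deleting the point `o`: the traces
`K ∖ {o}`, for `K ∈ 𝓚`, regarded as subsets of the space `P ∖ {o}`. -/
def puncturedLines {P : Type u} (𝓚 : Set (Set P)) (o : P) : Set (Set {x : P // x ≠ o}) :=
  (fun K => Subtype.val ⁻¹' K) '' 𝓚

/-- The map sending a line to its trace in the punctured plane. -/
def traceLine {P : Type u} (𝓚 : Set (Set P)) (o : P) (K : 𝓚) : puncturedLines 𝓚 o :=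
  ⟨Subtype.val ⁻¹' (K : Set P), (K : Set P), K.2, rfl⟩

/-- The topology on the lines of the punctured plane is carried over from `𝓚` by `traceLine`. -/
instance puncturedLinesTopology {P : Type u} (𝓚 : Set (Set P)) [TopologicalSpace 𝓚] (o : P) :
    TopologicalSpace (puncturedLines 𝓚 o) :=
  TopologicalSpace.coinduced (traceLine 𝓚 o) inferInstance

/-- Isomorphism of planes: homeomorphisms of the point spaces and of the line spaces preserving
incidence in both directions. -/
def PlanesIsomorphic (M : Type u) [TopologicalSpace M] (𝓛 : Set (Set M)) [TopologicalSpace 𝓛]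
    (N : Type u) [TopologicalSpace N] (𝓚 : Set (Set N)) [TopologicalSpace 𝓚] : Prop :=
  ∃ (f : M ≃ₜ N) (g : 𝓛 ≃ₜ 𝓚),
    ∀ (p : M) (L : 𝓛), p ∈ (L : Set M) ↔ f p ∈ (g L : Set N)

/-- A punctured projective plane: (up to isomorphism) a projective plane with just one point
deleted. -/
def IsPuncturedProjectivePlane (M : Type u) [TopologicalSpace M]
    (𝓛 : Set (Set M)) [TopologicalSpace 𝓛] : Prop :=
  ∃ (P : Type u) (_ : TopologicalSpace P) (𝓚 : Set (Set P)) (_ : TopologicalSpace 𝓚) (o : P),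
    IsProjectivePlane P 𝓚 ∧
      PlanesIsomorphic M 𝓛 {x : P // x ≠ o} (puncturedLines 𝓚 o)

open Set Filter Topology TopologicalSpace

/-! The classification is decided by which lines are compact. In a semiaffine stable plane a compact
line meets every line (`inter_nonempty_of_isCompact`), while a noncompact line is missed by some
line through each point off it (`exists_disjoint_of_not_isCompact`). So the plane is affine if no
line is compact and projective if all are. If both kinds occur, the noncompact lines are pairwise
parallel (`parallel_of_not_isCompact`), and adding a common point at infinity to them gives a
projective plane on the one-point compactification (`isProjectivePlane_extend`).

Both facts rest on pencils being connected and compact. Positive dimension provides small continua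
through one point; projections carry them to every point of every line (`hasContinua_line`), and
this makes pencils connected (`isPreconnected_pencil`), so that no line is isolated in its pencil.
Connectedness also forces a line leaving a compact set to cross its frontier
(`line_subset_of_disjoint_frontier`). Pencils are then compact (`isCompact_pencil`): semiaffinity
leaves at most one exceptional line in the covering argument, and a nonisolated line cannot be an
exception to a closed condition.

Conversely, disjoint lines of a punctured projective plane are those that met in the deleted point,
so the only possible parallel through a point is its join with the deleted point. -/

theorem continuousAt_of_continuous_subtype {X Y : Type*} [TopologicalSpace X] [TopologicalSpace Y]
    {P : X → Prop} (ho : IsOpen {x | P x}) {f : X → Y} {g : {x // P x} → Y}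
    (hfg : ∀ x, f x.1 = g x) (hg : Continuous g) {x : X} (hx : P x) : ContinuousAt f x := by
  have key := ho.isOpenEmbedding_subtypeVal.continuousAt_iff (x := ⟨x, hx⟩) (g := f)
  refine key.1 ?_
  have e : f ∘ (Subtype.val : {x | P x} → _) = g := funext hfg
  rw [e]
  exact hg.continuousAt

theorem Fin.exists_three_ne (i : Fin 4) :
    ∃ j k l : Fin 4, j ≠ i ∧ k ≠ i ∧ l ≠ i ∧ j ≠ k ∧ j ≠ l ∧ k ≠ l := by
  revert i
  decide

/-! ### Joining, meeting and closedness of incidence -/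

namespace IsStablePlane

variable {M : Type u} [TopologicalSpace M] {𝓛 : Set (Set M)} [TopologicalSpace 𝓛]

section Basic

variable (h : IsStablePlane M 𝓛)
include h

theorem nonempty_points : Nonempty M :=
  let ⟨a, _⟩ := h.exists_quadrangle
  ⟨a 0⟩

theorem nonempty_lines : Nonempty 𝓛 := by
  obtain ⟨a, ha, -⟩ := h.exists_quadrangle
  obtain ⟨L, -⟩ := h.existsUnique_join (a 0) (a 1) (ha.ne (by decide))
  exact ⟨L⟩

omit h in
/-- The line joining two distinct points (an arbitrary line if they coincide). -/
noncomputable def join (h : IsStablePlane M 𝓛) (p q : M) : 𝓛 :=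
  @Classical.epsilon 𝓛 h.nonempty_lines fun L => p ∈ L.1 ∧ q ∈ L.1

omit h in
/-- The intersection point of two distinct intersecting lines (an arbitrary point of the
intersection, or of the plane, in the other cases). -/
noncomputable def meet (h : IsStablePlane M 𝓛) (K L : 𝓛) : M :=
  @Classical.epsilon M h.nonempty_points fun x => x ∈ K.1 ∧ x ∈ L.1

theorem mem_join {p q : M} (hpq : p ≠ q) : p ∈ (h.join p q).1 ∧ q ∈ (h.join p q).1 :=
  Classical.epsilon_spec (p := fun L : 𝓛 => p ∈ L.1 ∧ q ∈ L.1)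
    (h.existsUnique_join p q hpq).exists

theorem left_mem_join {p q : M} (hpq : p ≠ q) : p ∈ (h.join p q).1 := (h.mem_join hpq).1

theorem right_mem_join {p q : M} (hpq : p ≠ q) : q ∈ (h.join p q).1 := (h.mem_join hpq).2

theorem line_eq {p q : M} (hpq : p ≠ q) {K L : 𝓛} (hpK : p ∈ K.1) (hqK : q ∈ K.1)
    (hpL : p ∈ L.1) (hqL : q ∈ L.1) : K = L :=
  (h.existsUnique_join p q hpq).unique ⟨hpK, hqK⟩ ⟨hpL, hqL⟩

theorem join_eq {p q : M} (hpq : p ≠ q) {L : 𝓛} (hp : p ∈ L.1) (hq : q ∈ L.1) :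
    h.join p q = L :=
  h.line_eq hpq (h.left_mem_join hpq) (h.right_mem_join hpq) hp hq

theorem point_eq {K L : 𝓛} (hKL : K ≠ L) {x y : M} (hxK : x ∈ K.1) (hxL : x ∈ L.1)
    (hyK : y ∈ K.1) (hyL : y ∈ L.1) : x = y :=
  by_contra fun hxy => hKL (h.line_eq hxy hxK hyK hxL hyL)

theorem mem_meet {K L : 𝓛} (hKL : (K.1 ∩ L.1).Nonempty) :
    h.meet K L ∈ K.1 ∧ h.meet K L ∈ L.1 :=
  Classical.epsilon_spec (p := fun x : M => x ∈ K.1 ∧ x ∈ L.1) hKL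

theorem meet_eq {K L : 𝓛} (hKL : K ≠ L) {x : M} (hxK : x ∈ K.1) (hxL : x ∈ L.1) :
    h.meet K L = x :=
  have hm := h.mem_meet ⟨x, hxK, hxL⟩
  h.point_eq hKL hm.1 hm.2 hxK hxL

theorem continuousAt_join {p q : M} (hpq : p ≠ q) :
    ContinuousAt (fun x : M × M => h.join x.1 x.2) (p, q) := by
  have := h.t2_points
  obtain ⟨j, hj, hjc⟩ := h.continuous_join
  exact continuousAt_of_continuous_subtype (P := fun x : M × M => x.1 ≠ x.2)
    (isOpen_ne_fun continuous_fst continuous_snd)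
    (fun x => h.join_eq x.2 (hj x).1 (hj x).2) hjc hpq

theorem continuousAt_meet {K L : 𝓛} (hKL : K ≠ L) (hm : (K.1 ∩ L.1).Nonempty) :
    ContinuousAt (fun x : 𝓛 × 𝓛 => h.meet x.1 x.2) (K, L) := by
  obtain ⟨m, hm', hmc⟩ := h.continuous_meet
  exact continuousAt_of_continuous_subtype
    (P := fun x : 𝓛 × 𝓛 => x.1 ≠ x.2 ∧ ((x.1 : Set M) ∩ (x.2 : Set M)).Nonempty)
    h.isOpen_intersecting (fun x => h.meet_eq x.2.1 (hm' x).1 (hm' x).2) hmc ⟨hKL, hm⟩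

theorem eventually_intersecting {K L : 𝓛} (hKL : K ≠ L) (hm : (K.1 ∩ L.1).Nonempty) :
    ∀ᶠ x : 𝓛 × 𝓛 in 𝓝 (K, L), x.1 ≠ x.2 ∧ (x.1.1 ∩ x.2.1).Nonempty :=
  h.isOpen_intersecting.mem_nhds (show K ≠ L ∧ _ from ⟨hKL, hm⟩)

theorem tendsto_join {α : Type*} {f : Filter α} {u v : α → M} {p q : M} (hpq : p ≠ q)
    (hu : Tendsto u f (𝓝 p)) (hv : Tendsto v f (𝓝 q)) :
    Tendsto (fun a => h.join (u a) (v a)) f (𝓝 (h.join p q)) :=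
  (h.continuousAt_join hpq).tendsto.comp (hu.prodMk_nhds hv)

theorem tendsto_meet {α : Type*} {f : Filter α} {u v : α → 𝓛} {K L : 𝓛} (hKL : K ≠ L)
    (hm : (K.1 ∩ L.1).Nonempty) (hu : Tendsto u f (𝓝 K)) (hv : Tendsto v f (𝓝 L)) :
    Tendsto (fun a => h.meet (u a) (v a)) f (𝓝 (h.meet K L)) :=
  (h.continuousAt_meet hKL hm).tendsto.comp (hu.prodMk_nhds hv)

theorem eventually_meet {α : Type*} {f : Filter α} {u v : α → 𝓛} {K L : 𝓛} (hKL : K ≠ L)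
    (hm : (K.1 ∩ L.1).Nonempty) (hu : Tendsto u f (𝓝 K)) (hv : Tendsto v f (𝓝 L)) :
    ∀ᶠ a in f, u a ≠ v a ∧ ((u a).1 ∩ (v a).1).Nonempty :=
  (hu.prodMk_nhds hv).eventually (h.eventually_intersecting hKL hm)

theorem exists_notMem_line (L : 𝓛) : ∃ p, p ∉ L.1 := by
  obtain ⟨a, -, ha⟩ := h.exists_quadrangle
  by_contra! hL
  exact ha 0 1 2 (by decide) (by decide) (by decide) L L.2 ⟨hL _, hL _, hL _⟩

theorem exists_point_ne (p : M) : ∃ q, q ≠ p := by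
  obtain ⟨a, ha, -⟩ := h.exists_quadrangle
  by_contra! hp
  exact ha.ne (show (0 : Fin 4) ≠ 1 by decide) ((hp _).trans (hp _).symm)

theorem exists_line_through (p : M) : ∃ K : 𝓛, p ∈ K.1 := by
  obtain ⟨q, hq⟩ := h.exists_point_ne p
  exact ⟨h.join q p, h.right_mem_join hq⟩

theorem exists_line_through_ne (p : M) (L : 𝓛) : ∃ K : 𝓛, K ≠ L ∧ p ∈ K.1 := by
  by_cases hp : p ∈ L.1
  · obtain ⟨q, hq⟩ := h.exists_notMem_line L
    have hqp : q ≠ p := fun e => hq (e ▸ hp)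
    exact ⟨h.join q p, fun e => hq (e ▸ h.left_mem_join hqp), h.right_mem_join hqp⟩
  · obtain ⟨K, hK⟩ := h.exists_line_through p
    exact ⟨K, fun e => hp (e ▸ hK), hK⟩

/-- Off any point `q` there is a point on two distinct lines avoiding `q`. -/
theorem exists_two_lines_avoiding (q : M) :
    ∃ p, ∃ K₁ K₂ : 𝓛, K₁ ≠ K₂ ∧ p ∈ K₁.1 ∧ p ∈ K₂.1 ∧ q ∉ K₁.1 ∧ q ∉ K₂.1 := by
  obtain ⟨a, ha, hnc⟩ := h.exists_quadrangle
  obtain ⟨i, hi⟩ : ∃ i, a i ≠ q := by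
    by_contra! hq
    exact ha.ne (show (0 : Fin 4) ≠ 1 by decide) ((hq _).trans (hq _).symm)
  have hJ : ∀ j k, j ≠ i → k ≠ i → j ≠ k → h.join (a i) (a j) ≠ h.join (a i) (a k) := by
    intro j k hj hk hjk e
    refine hnc i j k hj.symm hk.symm hjk _ (h.join (a i) (a j)).2
      ⟨h.left_mem_join (ha.ne hj.symm), h.right_mem_join (ha.ne hj.symm), ?_⟩
    rw [e]
    exact h.right_mem_join (ha.ne hk.symm)
  have hl : ∀ j, j ≠ i → a i ∈ (h.join (a i) (a j)).1 := fun j hj =>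
    h.left_mem_join (ha.ne hj.symm)
  have hq : ∀ j k, j ≠ i → k ≠ i → j ≠ k → q ∈ (h.join (a i) (a j)).1 →
      q ∉ (h.join (a i) (a k)).1 := fun j k hj hk hjk h1 h2 =>
    hJ j k hj hk hjk (h.line_eq hi (hl j hj) h1 (hl k hk) h2)
  -- The three lines from `a i` to the other corners share only `a i`, so `q` is on at most one of
  -- them.
  obtain ⟨j, k, l, hj, hk, hl', hjk, hjl, hkl⟩ := Fin.exists_three_ne i
  by_cases h1 : q ∈ (h.join (a i) (a j)).1
  · exact ⟨a i, _, _, hJ k l hk hl' hkl, hl k hk, hl l hl', hq j k hj hk hjk h1,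
      hq j l hj hl' hjl h1⟩
  · by_cases h2 : q ∈ (h.join (a i) (a k)).1
    · exact ⟨a i, _, _, hJ j l hj hl' hjl, hl j hj, hl l hl', h1, hq k l hk hl' hkl h2⟩
    · exact ⟨a i, _, _, hJ j k hj hk hjk, hl j hj, hl k hk, h1, h2⟩

theorem exists_line_avoiding (q : M) : ∃ L : 𝓛, q ∉ L.1 :=
  let ⟨_, K, _, _, _, _, hK, _⟩ := h.exists_two_lines_avoiding q
  ⟨K, hK⟩

/-- The axioms alone do not obviously exclude lines with at most one point. Semiaffinity does: a
line inside `{q}` would be missed by two lines through a common point that avoid `q`. -/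
theorem exists_mem_line_ne (hs : IsSemiaffine 𝓛) (L : 𝓛) (q : M) : ∃ x ∈ L.1, x ≠ q := by
  by_contra! hL
  obtain ⟨p, K₁, K₂, hne, h1, h2, h3, h4⟩ := h.exists_two_lines_avoiding q
  have hd : ∀ K : 𝓛, q ∉ K.1 → Disjoint K.1 L.1 := fun K hK =>
    Set.disjoint_left.2 fun x hxK hxL => hK (hL x hxL ▸ hxK)
  have hp : p ∉ L.1 := fun hpL => h3 (hL p hpL ▸ h1)
  exact hne (Subtype.ext (hs _ L.2 p hp _ K₁.2 _ K₂.2 h1 h2 (hd _ h3) (hd _ h4)))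

theorem line_nonempty (hs : IsSemiaffine 𝓛) (L : 𝓛) : L.1.Nonempty :=
  let ⟨p⟩ := h.nonempty_points
  let ⟨x, hx, _⟩ := h.exists_mem_line_ne hs L p
  ⟨x, hx⟩

/-- Incidence is a closed relation. -/
theorem isClosed_incidence (hs : IsSemiaffine 𝓛) :
    IsClosed {x : M × 𝓛 | x.1 ∈ x.2.1} := by
  have := h.t2_points
  refine isClosed_iff_frequently.2 fun ⟨x, L⟩ hf => ?_
  by_contra hx
  obtain ⟨q, hq⟩ := h.line_nonempty hs L
  have hxq : x ≠ q := fun e => hx (e ▸ hq)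
  have hKL : h.join x q ≠ L := fun e => hx (e ▸ h.left_mem_join hxq)
  have hm : ((h.join x q).1 ∩ L.1).Nonempty := ⟨q, h.right_mem_join hxq, hq⟩
  -- For `(y, K)` close to `(x, L)`, the line joining `y` and `q` meets `K` near `q`. If `y` were on
  -- `K`, this meeting point would be `y` itself, which is near `x`.
  have hc : Tendsto (fun y : M × 𝓛 => (h.join y.1 q, y.2)) (𝓝 (x, L)) (𝓝 (h.join x q, L)) := by
    exact (h.tendsto_join hxq (continuous_fst.tendsto (x, L)) tendsto_const_nhds).prodMk_nhds
      (continuous_snd.tendsto (x, L))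
  have hmt := ((h.continuousAt_meet hKL hm).tendsto.comp hc)
  have hq' : h.meet (h.join x q) L = q := h.meet_eq hKL (h.right_mem_join hxq) hq
  simp only [hq'] at hmt
  have hft : Tendsto (fun y : M × 𝓛 => y.1) (𝓝 (x, L)) (𝓝 x) := continuous_fst.continuousAt
  obtain ⟨U, V, hU, hV, hxU, hqV, hUV⟩ := t2_separation hxq
  have e1 := hmt.eventually (hV.mem_nhds hqV)
  have e2 := hft.eventually (hU.mem_nhds hxU)
  have e3 := hc.eventually (h.eventually_intersecting hKL hm)
  have e4 := hft.eventually (isOpen_ne.mem_nhds hxq)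
  obtain ⟨y, hy, y1, y2, y3, y4⟩ := (hf.and_eventually (e1.and (e2.and (e3.and e4)))).exists
  have : h.meet (h.join y.1 q) y.2 = y.1 := h.meet_eq y3.1 (h.left_mem_join y4) hy
  simp only [Function.comp_apply, this] at y1
  exact Set.disjoint_left.1 hUV y2 y1

theorem isClosed_line (hs : IsSemiaffine 𝓛) (L : 𝓛) : IsClosed L.1 :=
  (h.isClosed_incidence hs).preimage (f := fun x : M => (x, L)) (by fun_prop)

end Basic

/-- The lines through a point. -/
def pencil (𝓛 : Set (Set M)) (q : M) : Set 𝓛 := {L | q ∈ L.1}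

theorem isClosed_pencil (h : IsStablePlane M 𝓛) (hs : IsSemiaffine 𝓛) (q : M) :
    IsClosed (pencil 𝓛 q) :=
  (h.isClosed_incidence hs).preimage (f := fun L : 𝓛 => (q, L)) (by fun_prop)

end IsStablePlane

/-! ### Positive dimension and small continua -/

theorem smallInductiveDimension_pos_iff {X : Type*} [TopologicalSpace X] :
    0 < smallInductiveDimension X ↔
      ∃ x : X, ∃ U ∈ 𝓝 x, ∀ C, IsClopen C → x ∈ C → ¬ C ⊆ U := by
  -- Dimension at most zero means that the clopen sets form a basis.
  rw [← not_le, ← Nat.cast_zero, smallInductiveDimension_le_iff, HasSmallInductiveDimensionLE,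
    zero_add, hasSmallInductiveDimensionLT_one_iff]
  constructor
  · contrapose!
    intro hx
    refine isTopologicalBasis_of_isOpen_of_nhds (fun u hu => hu.2) fun x U hxU hU => ?_
    obtain ⟨C, hC, hxC, hCU⟩ := hx x U (hU.mem_nhds hxU)
    exact ⟨C, hC, hxC, hCU⟩
  · rintro ⟨x, U, hU, hx⟩ hb
    obtain ⟨C, hC, hxC, hCU⟩ := hb.mem_nhds_iff.1 hU
    exact hx C hC hxC hCU

theorem Homeomorph.smallInductiveDimension_pos {X Y : Type*} [TopologicalSpace X]
    [TopologicalSpace Y] (e : X ≃ₜ Y) (hX : 0 < smallInductiveDimension X) :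
    0 < smallInductiveDimension Y := by
  rw [smallInductiveDimension_pos_iff] at hX ⊢
  obtain ⟨x, U, hU, hx⟩ := hX
  refine ⟨e x, e.symm ⁻¹' U, e.symm.continuous.continuousAt.preimage_mem_nhds (by simpa), ?_⟩
  intro C hC hxC hCU
  exact hx (e ⁻¹' C) (hC.preimage e.continuous) hxC fun z hz => by simpa using hCU hz

theorem IsPreconnected.smallInductiveDimension_pos {X : Type*} [TopologicalSpace X] [T1Space X]
    {S : Set X} (hS : IsPreconnected S) {x y : X} (hx : x ∈ S) (hy : y ∈ S) (hxy : x ≠ y) :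
    0 < smallInductiveDimension X :=
  smallInductiveDimension_pos_iff.2 ⟨x, {y}ᶜ, isOpen_ne.mem_nhds hxy, fun _ hC hxC hCU =>
    hCU (hS.subset_isClopen hC ⟨x, hx, hxC⟩ hy) rfl⟩

/-- The set `A` contains arbitrarily small nondegenerate continua through `x`. -/
def HasContinua {X : Type*} [TopologicalSpace X] (A : Set X) (x : X) : Prop :=
  ∀ N ∈ 𝓝 x, ∃ S ⊆ A ∩ N, IsCompact S ∧ IsPreconnected S ∧ x ∈ S ∧ ∃ y ∈ S, y ≠ x

theorem HasContinua.exists_mem_notMem {X : Type*} [TopologicalSpace X] [T1Space X] {A : Set X}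
    {x : X} (hA : HasContinua A x) {F : Set X} (hF : F.Finite) :
    ∃ y ∈ A, y ≠ x ∧ y ∉ F := by
  have hN : (F \ {x})ᶜ ∈ 𝓝 x :=
    (hF.subset sdiff_subset).isClosed.isOpen_compl.mem_nhds (by simp)
  obtain ⟨S, hS, -, -, -, y, hy, hyx⟩ := hA _ hN
  exact ⟨y, (hS hy).1, hyx, fun hyF => (hS hy).2 ⟨hyF, hyx⟩⟩

/-- Take a point with a neighbourhood `U` containing no clopen neighbourhood of it, and its
component in a small compact neighbourhood `K`. This component is an intersection of clopen subsets
of `K`. Were it a singleton, one of these would lie in the interior of `K`, hence be clopen in the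
whole space and contained in `U`. -/
theorem exists_hasContinua {X : Type*} [TopologicalSpace X] [T2Space X] [LocallyCompactSpace X]
    (hX : 0 < smallInductiveDimension X) : ∃ x : X, HasContinua univ x := by
  obtain ⟨x, U, hU, hx⟩ := smallInductiveDimension_pos_iff.1 hX
  refine ⟨x, fun N hN => ?_⟩
  obtain ⟨K, hK, hKUN, hKc⟩ := local_compact_nhds (inter_mem hU hN)
  have : CompactSpace K := isCompact_iff_compactSpace.1 hKc
  let x' : K := ⟨x, mem_of_mem_nhds hK⟩
  refine ⟨Subtype.val '' connectedComponent x', ?_,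
    isClosed_connectedComponent.isCompact.image continuous_subtype_val,
    isPreconnected_connectedComponent.image _ continuous_subtype_val.continuousOn,
    ⟨x', mem_connectedComponent, rfl⟩, ?_⟩
  · rintro _ ⟨y, -, rfl⟩
    exact ⟨trivial, (hKUN y.2).2⟩
  by_contra! hc
  have hcc : connectedComponent x' ⊆ {x'} := fun y hy =>
    Subtype.ext (hc y.1 ⟨y, hy, rfl⟩)
  rw [connectedComponent_eq_iInter_isClopen] at hcc
  obtain ⟨⟨Q, hQ, hxQ⟩, hQK⟩ :
      ∃ Q : {s : Set K // IsClopen s ∧ x' ∈ s}, Q.1 ⊆ Subtype.val ⁻¹' interior K := by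
    have : Nonempty {s : Set K // IsClopen s ∧ x' ∈ s} := ⟨⟨univ, isClopen_univ, mem_univ _⟩⟩
    refine exists_subset_nhds_of_compactSpace (V := fun s : {s : Set K // IsClopen s ∧ x' ∈ s} =>
      s.1) ?_ (fun s => s.2.1.1) ?_
    · rintro ⟨s, hs, hxs⟩ ⟨t, ht, hxt⟩
      exact ⟨⟨s ∩ t, hs.inter ht, ⟨hxs, hxt⟩⟩, inter_subset_left, inter_subset_right⟩
    · intro y hy
      rw [show y = x' from hcc hy]
      exact (isOpen_interior.preimage continuous_subtype_val).mem_nhds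
        (mem_interior_iff_mem_nhds.2 hK)
  obtain ⟨V, hV, rfl⟩ := isOpen_induced_iff.1 hQ.2
  have himg : Subtype.val '' (Subtype.val ⁻¹' V : Set K) = V ∩ interior K := by
    ext y
    constructor
    · rintro ⟨z, hz, rfl⟩
      exact ⟨hz, hQK hz⟩
    · rintro ⟨hyV, hyK⟩
      exact ⟨⟨y, interior_subset hyK⟩, hyV, rfl⟩
  refine hx (Subtype.val '' (Subtype.val ⁻¹' V : Set K)) ⟨?_, ?_⟩ ⟨x', hxQ, rfl⟩ ?_
  · exact (hQ.1.isCompact.image continuous_subtype_val).isClosed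
  · rw [himg]
    exact hV.inter isOpen_interior
  · rintro _ ⟨y, -, rfl⟩
    exact (hKUN y.2).1

theorem Fin.exists_pair_of_cover {R Z : Fin 4 → Prop} (hcover : ∀ i, R i ∨ Z i)
    (hZ : ∀ i j k, i ≠ j → i ≠ k → j ≠ k → ¬ (Z i ∧ Z j ∧ Z k)) :
    ∃ i j, i ≠ j ∧ R i ∧ R j ∧ ¬ Z i ∧ ¬ Z j := by
  have hpair : ∃ i j, i ≠ j ∧ ¬ Z i ∧ ¬ Z j := by
    by_contra! hc
    obtain ⟨i, hi⟩ : ∃ i, ¬ Z i := by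
      by_contra! hall
      exact hZ 0 1 2 (by decide) (by decide) (by decide) ⟨hall _, hall _, hall _⟩
    obtain ⟨j, k, l, hj, hk, hl, hjk, hjl, hkl⟩ := Fin.exists_three_ne i
    exact hZ j k l hjk hjl hkl ⟨hc i j hj.symm hi, hc i k hk.symm hi, hc i l hl.symm hi⟩
  obtain ⟨i, j, hij, hi, hj⟩ := hpair
  exact ⟨i, j, hij, (hcover i).resolve_right hi, (hcover j).resolve_right hj, hi, hj⟩

/-! ### Continua in lines -/

namespace IsStablePlane

variable {M : Type u} [TopologicalSpace M] {𝓛 : Set (Set M)} [TopologicalSpace 𝓛]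
  (h : IsStablePlane M 𝓛)
include h

theorem join_ne_of_notMem {r x : M} {K : 𝓛} (hrx : r ≠ x) (hrK : r ∉ K.1) : h.join r x ≠ K :=
  fun e => hrK (e ▸ h.left_mem_join hrx)

/-- The projection with centre `r` to the line `K` is locally defined and continuous. -/
theorem eventually_projection {r x y : M} {K : 𝓛} (hrx : r ≠ x) (hrK : r ∉ K.1) (hyK : y ∈ K.1)
    (hy : y ∈ (h.join r x).1) :
    ∀ᶠ s in 𝓝 x, r ≠ s ∧ ContinuousAt (fun s => h.meet (h.join r s) K) s ∧
      h.meet (h.join r s) K ∈ (h.join r s).1 ∧ h.meet (h.join r s) K ∈ K.1 := by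
  have := h.t2_points
  have e1 : ∀ᶠ s in 𝓝 x, r ≠ s := eventually_ne_nhds hrx.symm |>.mono fun _ => Ne.symm
  have e2 := h.eventually_meet (f := 𝓝 x) (h.join_ne_of_notMem hrx hrK) ⟨y, hy, hyK⟩
    (h.tendsto_join hrx tendsto_const_nhds tendsto_id) tendsto_const_nhds
  filter_upwards [e1, e2] with s h1 h2
  have hm := h.mem_meet h2.2
  exact ⟨h1, h.tendsto_meet h2.1 h2.2 (h.tendsto_join h1 tendsto_const_nhds tendsto_id)
    tendsto_const_nhds, hm.1, hm.2⟩

/-- The image of `S` under projection from `r` is a continuum. It is nondegenerate because only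
points of the line through `r` and `x` project to `y`. -/
theorem exists_projected_continuum {r x y : M} {K : 𝓛} (hrx : r ≠ x) (hrK : r ∉ K.1)
    (hyK : y ∈ K.1) (hy : y ∈ (h.join r x).1) {V : Set M} (hV : V ∈ 𝓝 y) :
    ∃ N ∈ 𝓝 x, ∀ S ⊆ N, IsCompact S → IsPreconnected S → x ∈ S →
      (∃ c ∈ S, c ∉ (h.join r x).1) →
      ∃ S' ⊆ K.1 ∩ V, IsCompact S' ∧ IsPreconnected S' ∧ y ∈ S' ∧ ∃ c ∈ S', c ≠ y := by
  have hproj := h.eventually_projection hrx hrK hyK hy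
  have hfx : h.meet (h.join r x) K = y := h.meet_eq (h.join_ne_of_notMem hrx hrK) hy hyK
  have hVx : ∀ᶠ s in 𝓝 x, h.meet (h.join r s) K ∈ V :=
    by
    have hc := hproj.self_of_nhds.2.1.tendsto
    simp only [hfx] at hc
    exact hc hV
  refine ⟨_, hproj.and hVx, fun S hS hSc hSp hxS => ?_⟩
  rintro ⟨c, hcS, hc⟩
  have hcont : ContinuousOn (fun s => h.meet (h.join r s) K) S :=
    fun s hs => (hS hs).1.2.1.continuousWithinAt
  refine ⟨_, ?_, hSc.image_of_continuousOn hcont, hSp.image _ hcont, ⟨x, hxS, hfx⟩, _,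
    ⟨c, hcS, rfl⟩, fun e => hc ?_⟩
  · rintro _ ⟨s, hs, rfl⟩
    exact ⟨(hS hs).1.2.2.2, (hS hs).2⟩
  · have hyc : y ∈ (h.join r c).1 := e ▸ (hS hcS).1.2.2.1
    have hrc := (hS hcS).1.1
    have hry : r ≠ y := fun e => hrK (e ▸ hyK)
    rw [h.line_eq hry (h.left_mem_join hrx) hy (h.left_mem_join hrc) hyc]
    exact h.right_mem_join hrc

theorem hasContinua_project {Z K : 𝓛} {r x y : M} (hZ : HasContinua Z.1 x) (hxZ : x ∈ Z.1)
    (hrZ : r ∉ Z.1) (hrK : r ∉ K.1) (hyK : y ∈ K.1) (hy : y ∈ (h.join r x).1) :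
    HasContinua K.1 y := by
  have hrx : r ≠ x := fun e => hrZ (e ▸ hxZ)
  intro V hV
  obtain ⟨N, hN, H⟩ := h.exists_projected_continuum hrx hrK hyK hy hV
  obtain ⟨S, hS, hSc, hSp, hxS, c, hcS, hcx⟩ := hZ N hN
  refine H S (fun s hs => (hS hs).2) hSc hSp hxS ⟨c, hcS, fun hc => hcx ?_⟩
  exact h.point_eq (h.join_ne_of_notMem hrx hrZ) hc (hS hcS).1 (h.right_mem_join hrx) hxZ

/-- Either the line through `a` and `x` contains small continua through `x`, or small continua at
`x` are not contained in it, and then their projections from `a` to `Z` are nondegenerate. -/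
theorem exists_line_hasContinua_of_univ {x : M} (hx : HasContinua univ x) :
    ∃ Z : 𝓛, x ∈ Z.1 ∧ HasContinua Z.1 x := by
  obtain ⟨Z, hxZ⟩ := h.exists_line_through x
  obtain ⟨a, haZ⟩ := h.exists_notMem_line Z
  have hax : a ≠ x := fun e => haZ (e ▸ hxZ)
  by_cases hR : HasContinua (h.join a x).1 x
  · exact ⟨_, h.right_mem_join hax, hR⟩
  refine ⟨Z, hxZ, fun V hV => ?_⟩
  simp only [HasContinua, not_forall, exists_prop] at hR
  obtain ⟨N₀, hN₀, hR⟩ := hR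
  obtain ⟨N, hN, H⟩ := h.exists_projected_continuum hax haZ hxZ (h.right_mem_join hax) hV
  obtain ⟨S, hS, hSc, hSp, hxS, hS'⟩ := hx _ (inter_mem hN hN₀)
  refine H S (fun s hs => (hS hs).2.1) hSc hSp hxS ?_
  by_contra! hc
  exact hR ⟨S, fun s hs => ⟨hc s hs, (hS hs).2.2⟩, hSc, hSp, hxS, hS'⟩

/-- Two intersecting lines, one of them containing continua, do not cover the plane. -/
theorem exists_notMem_two_lines (hs : IsSemiaffine 𝓛) {R Z : 𝓛} {x : M} (hRZ : R ≠ Z)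
    (hxR : x ∈ R.1) (hxZ : x ∈ Z.1) (hZ : HasContinua Z.1 x) : ∃ b, b ∉ R.1 ∧ b ∉ Z.1 := by
  have := h.t2_points
  by_contra! hcov
  obtain ⟨a, ha, hnc⟩ := h.exists_quadrangle
  obtain ⟨i, j, hij, hi, hj, hi', hj'⟩ := Fin.exists_pair_of_cover
    (R := fun i => a i ∈ R.1) (Z := fun i => a i ∈ Z.1)
    (fun i => or_iff_not_imp_left.2 (hcov (a i)))
    (fun i j k hij hik hjk => hnc i j k hij hik hjk Z Z.2)
  obtain ⟨z₁, hz₁, hx₁, -⟩ := hZ.exists_mem_notMem finite_empty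
  obtain ⟨z₂, hz₂, hx₂, h21⟩ := hZ.exists_mem_notMem (finite_singleton z₁)
  obtain ⟨z₃, hz₃, hx₃, h3⟩ := hZ.exists_mem_notMem (toFinite {z₁, z₂})
  have hzR : ∀ z ∈ Z.1, z ≠ x → z ∉ R.1 := fun z hz hzx hzR =>
    hzx (h.point_eq hRZ hzR hz hxR hxZ)
  have hne : ∀ k, a k ∉ Z.1 → ∀ z ∈ Z.1, a k ≠ z := fun k hk z hz e => hk (e ▸ hz)
  have hLR : ∀ k, a k ∉ Z.1 → ∀ z ∈ Z.1, z ≠ x → h.join (a k) z ≠ R :=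
    fun k hk z hz hzx e => hzR z hz hzx (e ▸ h.right_mem_join (hne k hk z hz))
  have hLZ : ∀ k, a k ∉ Z.1 → ∀ z ∈ Z.1, h.join (a k) z ≠ Z :=
    fun k hk z hz => h.join_ne_of_notMem (hne k hk z hz) hk
  -- If `R` and `Z` cover the plane, two lines can meet only on one of them. These two meet `R` in
  -- `a j` and `a i`, and `Z` in `z` and `z₁`, so they are disjoint. Two choices of `z` then give
  -- two parallels through `a j`.
  have hdis : ∀ z ∈ Z.1, z ≠ x → z ≠ z₁ →
      Disjoint (h.join (a j) z).1 (h.join (a i) z₁).1 := by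
    refine fun z hz hzx hz1 => Set.disjoint_left.2 fun y hy hy' => ?_
    by_cases hyR : y ∈ R.1
    · have e1 := h.point_eq (hLR i hi' z₁ hz₁ hx₁) hy' hyR
        (h.left_mem_join (hne i hi' z₁ hz₁)) hi
      have e2 := h.point_eq (hLR j hj' z hz hzx) hy hyR (h.left_mem_join (hne j hj' z hz)) hj
      exact ha.ne hij (e1.symm.trans e2)
    · have hyZ := hcov y hyR
      have e1 := h.point_eq (hLZ i hi' z₁ hz₁) hy' hyZ (h.right_mem_join (hne i hi' z₁ hz₁)) hz₁
      have e2 := h.point_eq (hLZ j hj' z hz) hy hyZ (h.right_mem_join (hne j hj' z hz)) hz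
      exact hz1 (e2.symm.trans e1)
  have hjL : a j ∉ (h.join (a i) z₁).1 := fun hjL => hLR i hi' z₁ hz₁ hx₁
    (h.line_eq (ha.ne hij) (h.left_mem_join (hne i hi' z₁ hz₁)) hjL hi hj)
  have e : h.join (a j) z₂ = h.join (a j) z₃ := Subtype.ext <|
    hs _ (h.join (a i) z₁).2 (a j) hjL _ (h.join (a j) z₂).2 _ (h.join (a j) z₃).2
      (h.left_mem_join (hne j hj' z₂ hz₂)) (h.left_mem_join (hne j hj' z₃ hz₃))
      (hdis z₂ hz₂ hx₂ h21) (hdis z₃ hz₃ hx₃ fun e => h3 (by simp [e]))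
  have h23 : z₂ ≠ z₃ := fun e => h3 (by simp [e])
  refine hLZ j hj' z₂ hz₂ (h.line_eq h23 (h.right_mem_join (hne j hj' z₂ hz₂)) ?_ hz₂ hz₃)
  rw [e]
  exact h.right_mem_join (hne j hj' z₃ hz₃)

theorem hasContinua_of_mem_of_hasContinua (hs : IsSemiaffine 𝓛) {Z : 𝓛} {x : M} (hxZ : x ∈ Z.1)
    (hZ : HasContinua Z.1 x) {R : 𝓛} (hxR : x ∈ R.1) : HasContinua R.1 x := by
  by_cases hRZ : R = Z
  · rwa [hRZ]
  obtain ⟨b, hbR, hbZ⟩ := h.exists_notMem_two_lines hs hRZ hxR hxZ hZ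
  exact h.hasContinua_project hZ hxZ hbZ hbR hxR (h.right_mem_join fun e => hbZ (e ▸ hxZ))

/-- Each line contains arbitrarily small continua through each of its points. -/
theorem hasContinua_line (hs : IsSemiaffine 𝓛) {K : 𝓛} {p : M} (hp : p ∈ K.1) :
    HasContinua K.1 p := by
  have := h.t2_points
  have := h.locallyCompact_points
  obtain ⟨x, hx⟩ := exists_hasContinua h.dim_points_pos
  obtain ⟨Z₀, hxZ₀, hZ₀⟩ := h.exists_line_hasContinua_of_univ hx
  have hall : ∀ R : 𝓛, x ∈ R.1 → HasContinua R.1 x := fun R hR =>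
    h.hasContinua_of_mem_of_hasContinua hs hxZ₀ hZ₀ hR
  by_cases hxp : x = p
  · exact hxp ▸ hall K (hxp ▸ hp)
  -- A third point `r` of the line through `x` and `p` is the centre of a projection sending `x` to
  -- `p`.
  obtain ⟨r, hr, hrx, hrp⟩ := (hall _ (h.left_mem_join hxp)).exists_mem_notMem
    (finite_singleton p)
  obtain ⟨Z, hZ, hxZ⟩ := h.exists_line_through_ne x (h.join x p)
  obtain ⟨K', hK', hpK'⟩ := h.exists_line_through_ne p (h.join x p)
  have hrZ : r ∉ Z.1 := fun hrZ => hZ (h.line_eq hrx hrZ hxZ hr (h.left_mem_join hxp))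
  have hrK' : r ∉ K'.1 := fun hrK => hK' (h.line_eq hrp hrK hpK' hr (h.right_mem_join hxp))
  refine h.hasContinua_of_mem_of_hasContinua hs hpK'
    (h.hasContinua_project (hall Z hxZ) hxZ hrZ hrK' hpK' ?_) hp
  rw [h.join_eq hrx hr (h.left_mem_join hxp)]
  exact h.right_mem_join hxp

end IsStablePlane

/-! ### Connectedness and compactness of pencils -/

namespace IsStablePlane

variable {M : Type u} [TopologicalSpace M] {𝓛 : Set (Set M)} [TopologicalSpace 𝓛]
  (h : IsStablePlane M 𝓛)
include h

/-- Any `G` is linked to `H` inside the pencil as follows. A continuum `S` in `H` containing `p` and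
`x` is projected from `r` in `G` to a line joining `x` to a point `y` of `G` near `p`, and the
result is joined to `p`. Then `x` yields `H` and `p` yields `G`. -/
theorem isPreconnected_pencil (hs : IsSemiaffine 𝓛) (p : M) : IsPreconnected (pencil 𝓛 p) := by
  have := h.t2_points
  obtain ⟨H, hpH⟩ := h.exists_line_through p
  obtain ⟨S, hSH, hSc, hSp, hpS, x, hxS, hxp⟩ := h.hasContinua_line hs hpH univ univ_mem
  have hxH : x ∈ H.1 := (hSH hxS).1
  refine isPreconnected_of_forall H fun G hpG => ?_
  by_cases hGH : G = H
  · exact ⟨{H}, singleton_subset_iff.2 hpH, rfl, hGH, isPreconnected_singleton⟩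
  obtain ⟨r, hrG, hrp⟩ := h.exists_mem_line_ne hs G p
  have hrH : r ∉ H.1 := fun hrH => hGH (h.line_eq hrp hrG hpG hrH hpH)
  have hxG : x ∉ G.1 := fun hxG => hGH (h.line_eq hxp hxG hpG hxH hpH)
  have hrS : ∀ s ∈ S, r ≠ s := fun s hs e => hrH (e ▸ (hSH hs).1)
  have hxpH : h.join x p = H := h.join_eq hxp hxH hpH
  -- Compactness of `S` gives one neighbourhood of `p` that works for all `s`.
  have hev : ∀ᶠ y in 𝓝 p, ∀ s ∈ S,
      h.join r s ≠ h.join x y ∧ ((h.join r s).1 ∩ (h.join x y).1).Nonempty := by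
    refine hSc.eventually_forall_of_forall_eventually fun s hs => ?_
    refine h.eventually_meet (K := h.join r s) (L := h.join x p) ?_ ?_
      (h.tendsto_join (hrS s hs) tendsto_const_nhds (continuous_snd.tendsto (p, s)))
      (h.tendsto_join hxp tendsto_const_nhds (continuous_fst.tendsto (p, s)))
    · rw [hxpH]
      exact h.join_ne_of_notMem (hrS s hs) hrH
    · rw [hxpH]
      exact ⟨s, h.right_mem_join (hrS s hs), (hSH hs).1⟩
  obtain ⟨T, hTG, -, -, -, y, hyT, hyp⟩ := h.hasContinua_line hs hpG _ hev
  obtain ⟨hyG, hy⟩ := hTG hyT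
  have hxy : x ≠ y := fun e => hxG (e ▸ hyG)
  have hpZ : p ∉ (h.join x y).1 := fun hpZ => hxG <|
    h.line_eq hyp (h.right_mem_join hxy) hpZ hyG hpG ▸ h.left_mem_join hxy
  have hcont : ContinuousOn (fun s => h.join p (h.meet (h.join r s) (h.join x y))) S := by
    intro s hs
    have hp : p ≠ h.meet (h.join r s) (h.join x y) := fun e =>
      hpZ (e ▸ (h.mem_meet (hy s hs).2).2)
    exact (h.tendsto_join hp tendsto_const_nhds (h.tendsto_meet (hy s hs).1 (hy s hs).2
      (h.tendsto_join (hrS s hs) tendsto_const_nhds tendsto_id) tendsto_const_nhds)).mono_left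
      nhdsWithin_le_nhds
  refine ⟨(fun s => h.join p (h.meet (h.join r s) (h.join x y))) '' S, ?_, ⟨x, hxS, ?_⟩,
    ⟨p, hpS, ?_⟩, hSp.image _ hcont⟩
  · rintro _ ⟨s, hs, rfl⟩
    exact h.left_mem_join fun e => hpZ (e ▸ (h.mem_meet (hy s hs).2).2)
  · have e : h.meet (h.join r x) (h.join x y) = x :=
      h.meet_eq (hy x hxS).1 (h.right_mem_join (hrS x hxS)) (h.left_mem_join hxy)
    simp only [e]
    exact h.join_eq hxp.symm hpH hxH
  · have e : h.meet (h.join r p) (h.join x y) = y := by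
      refine h.meet_eq (hy p hpS).1 ?_ (h.right_mem_join hxy)
      rw [h.join_eq hrp hrG hpG]
      exact hyG
    simp only [e]
    exact h.join_eq hyp.symm hpG hyG

/-- No line is isolated in a pencil. -/
theorem pencil_subset_of_isClosed (hs : IsSemiaffine 𝓛) {p : M} {C : Set 𝓛} (hC : IsClosed C)
    {G : 𝓛} (hCG : pencil 𝓛 p ⊆ C ∪ {G}) : pencil 𝓛 p ⊆ C := by
  have := h.t2_lines
  intro K hK
  by_contra hKC
  obtain ⟨K', hK', hpK'⟩ := h.exists_line_through_ne p K
  obtain rfl : K = G := (hCG hK).resolve_left hKC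
  have hK'C : K' ∈ C := (hCG hpK').resolve_right hK'
  obtain ⟨J, -, hJC, rfl⟩ := isPreconnected_closed_iff.1 (h.isPreconnected_pencil hs p) C {K} hC
    isClosed_singleton hCG ⟨K', hpK', hK'C⟩ ⟨K, hK, rfl⟩
  exact hKC hJC

theorem continuousOn_join_of_notMem {r : M} {A : Set M} (hr : r ∉ A) :
    ContinuousOn (fun s => h.join r s) A := fun s hs =>
  (h.tendsto_join (p := r) (q := s) (fun e => hr (e ▸ hs)) tendsto_const_nhds tendsto_id).mono_left
    nhdsWithin_le_nhds

/-- A line that does not leave the compact set `N` through its frontier lies in `N`. -/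
theorem line_subset_of_disjoint_frontier (hs : IsSemiaffine 𝓛) {H : 𝓛} {N : Set M}
    (hN : IsCompact N) (hHN : (H.1 ∩ N).Nonempty) (hd : Disjoint H.1 (frontier N)) :
    H.1 ⊆ interior N := by
  have := h.t2_points
  have := h.t2_lines
  obtain ⟨r, hr⟩ := h.exists_notMem_line H
  have hrne : ∀ s ∈ H.1, r ≠ s := fun s hs e => hr (e ▸ hs)
  have hint : ∀ s ∈ H.1, s ∈ N → s ∈ interior N := fun s hs hsN => by
    by_contra hsi
    exact Set.disjoint_left.1 hd hs ⟨subset_closure hsN, hsi⟩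
  -- Seen from `r`, the part of `H` in `N` is a closed subset of the pencil. It is also open there,
  -- since this part lies in the interior of `N`; so it is the whole pencil.
  have hC : IsClosed ((fun s => h.join r s) '' (H.1 ∩ N)) :=
    ((hN.inter_left (h.isClosed_line hs H)).image_of_continuousOn
      (h.continuousOn_join_of_notMem fun hrH => hr hrH.1)).isClosed
  have hU : IsOpen {L : 𝓛 | (L ≠ H ∧ (L.1 ∩ H.1).Nonempty) ∧ h.meet L H ∈ interior N} := by
    refine isOpen_iff_mem_nhds.2 fun L hL => ?_
    exact (h.eventually_meet hL.1.1 hL.1.2 tendsto_id tendsto_const_nhds).and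
      ((h.tendsto_meet hL.1.1 hL.1.2 tendsto_id tendsto_const_nhds).eventually
        (isOpen_interior.mem_nhds hL.2))
  have hmeet : ∀ s ∈ H.1, h.meet (h.join r s) H = s := fun s hs =>
    h.meet_eq (h.join_ne_of_notMem (hrne s hs) hr) (h.right_mem_join (hrne s hs)) hs
  have hcov : pencil 𝓛 r ⊆ {L : 𝓛 | (L ≠ H ∧ (L.1 ∩ H.1).Nonempty) ∧ h.meet L H ∈ interior N} ∪
      ((fun s => h.join r s) '' (H.1 ∩ N))ᶜ := by
    intro L hL
    by_cases hLC : L ∈ (fun s => h.join r s) '' (H.1 ∩ N)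
    · obtain ⟨s, ⟨hs, hsN⟩, rfl⟩ := hLC
      refine Or.inl ⟨⟨h.join_ne_of_notMem (hrne s hs) hr, s, h.right_mem_join (hrne s hs), hs⟩, ?_⟩
      simp only [hmeet s hs]
      exact hint s hs hsN
    · exact Or.inr hLC
  have hdis : pencil 𝓛 r ∩
      ({L : 𝓛 | (L ≠ H ∧ (L.1 ∩ H.1).Nonempty) ∧ h.meet L H ∈ interior N} ∩
        ((fun s => h.join r s) '' (H.1 ∩ N))ᶜ) = ∅ := by
    refine Set.eq_empty_iff_forall_notMem.2 fun L hL => hL.2.2 ?_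
    have hm := h.mem_meet hL.2.1.1.2
    exact ⟨h.meet L H, ⟨hm.2, interior_subset hL.2.1.2⟩, h.join_eq (hrne _ hm.2) hL.1 hm.1⟩
  rcases isPreconnected_iff_subset_of_disjoint.1 (h.isPreconnected_pencil hs r) _ _ hU
    hC.isOpen_compl hcov hdis with h1 | h1
  · intro s hs
    rw [← hmeet s hs]
    exact (h1 (h.left_mem_join (hrne s hs))).2
  · obtain ⟨s, hs, hsN⟩ := hHN
    exact absurd ⟨s, ⟨hs, hsN⟩, rfl⟩ (h1 (h.left_mem_join (hrne s hs)))

/-- Let `N` be a compact neighbourhood of `p` missing a line `L`. A line through `q` that meets `L`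
leaves `N`, hence crosses the frontier. So the required compact set consists of joins of points near
`p` with frontier points. -/
theorem exists_isCompact_pencil_subset_nhds (hs : IsSemiaffine 𝓛) (p : M) :
    ∃ N ∈ 𝓝 p, ∃ C : Set 𝓛, IsCompact C ∧ ∀ q ∈ N, pencil 𝓛 q ⊆ C := by
  have := h.t2_points
  have := h.t2_lines
  have := h.locallyCompact_points
  obtain ⟨L, hL⟩ := h.exists_line_avoiding p
  obtain ⟨N, hNp, hNL, hN⟩ := local_compact_nhds
    ((h.isClosed_line hs L).isOpen_compl.mem_nhds hL)
  obtain ⟨N', hN'p, hN'N, hN'⟩ := local_compact_nhds (interior_mem_nhds.2 hNp)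
  have hF : IsCompact (frontier N) := hN.of_isClosed_subset isClosed_frontier
    hN.isClosed.frontier_subset
  have hne : ∀ q ∈ N', ∀ x ∈ frontier N, q ≠ x := fun q hq x hx e => hx.2 (e ▸ hN'N hq)
  refine ⟨N', hN'p, (fun x : M × M => h.join x.1 x.2) '' (N' ×ˢ frontier N),
    (hN'.prod hF).image_of_continuousOn fun x hx =>
      (h.continuousAt_join (hne _ hx.1 _ hx.2)).continuousWithinAt, fun q hq => ?_⟩
  have hC : IsClosed ((fun x => h.join q x) '' frontier N) :=
    (hF.image_of_continuousOn (h.continuousOn_join_of_notMem fun hqF => hne q hq q hqF rfl)).isClosed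
  have hmem : ∀ K : 𝓛, q ∈ K.1 → (K.1 ∩ L.1).Nonempty →
      K ∈ (fun x => h.join q x) '' frontier N := by
    rintro K hqK ⟨y, hyK, hyL⟩
    by_contra hK
    have hd : Disjoint K.1 (frontier N) := Set.disjoint_left.2 fun x hxK hxF =>
      hK ⟨x, hxF, h.join_eq (hne q hq x hxF) hqK hxK⟩
    exact hNL (interior_subset (h.line_subset_of_disjoint_frontier hs hN
      ⟨q, hqK, interior_subset (hN'N hq)⟩ hd hyK)) hyL
  have hsub : pencil 𝓛 q ⊆ (fun x => h.join q x) '' frontier N := by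
    -- By semiaffinity at most one line through `q` misses `L`; not being isolated in the pencil, it
    -- lies in the closed set as well.
    by_cases hG : ∃ G : 𝓛, q ∈ G.1 ∧ Disjoint G.1 L.1
    · obtain ⟨G, hqG, hGL⟩ := hG
      refine h.pencil_subset_of_isClosed hs hC (G := G) fun K hK => ?_
      by_cases hKL : Disjoint K.1 L.1
      · exact Or.inr (Subtype.ext (hs _ L.2 q (hNL (interior_subset (hN'N hq))) _ K.2 _ G.2 hK hqG
          hKL hGL))
      · exact Or.inl (hmem K hK (Set.not_disjoint_iff_nonempty_inter.1 hKL))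
    · intro K hK
      exact hmem K hK (Set.not_disjoint_iff_nonempty_inter.1 fun hKL => hG ⟨K, hK, hKL⟩)
  intro K hK
  obtain ⟨x, hx, rfl⟩ := hsub hK
  exact ⟨(q, x), ⟨hq, hx⟩, rfl⟩

/-- The lines meeting a compact set are contained in a compact set of lines. -/
theorem exists_isCompact_pencil_subset (hs : IsSemiaffine 𝓛) {Q : Set M} (hQ : IsCompact Q) :
    ∃ C : Set 𝓛, IsCompact C ∧ ∀ q ∈ Q, pencil 𝓛 q ⊆ C := by
  refine hQ.induction_on (p := fun Q => ∃ C : Set 𝓛, IsCompact C ∧ ∀ q ∈ Q, pencil 𝓛 q ⊆ C)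
    ⟨∅, isCompact_empty, by simp⟩ ?_ ?_ ?_
  · rintro A B hAB ⟨C, hC, hBC⟩
    exact ⟨C, hC, fun q hq => hBC q (hAB hq)⟩
  · rintro A B ⟨C, hC, hAC⟩ ⟨D, hD, hBD⟩
    refine ⟨C ∪ D, hC.union hD, fun q hq => ?_⟩
    rcases hq with hq | hq
    · exact (hAC q hq).trans subset_union_left
    · exact (hBD q hq).trans subset_union_right
  · intro p _
    obtain ⟨N, hN, C, hC⟩ := h.exists_isCompact_pencil_subset_nhds hs p
    exact ⟨N, mem_nhdsWithin_of_mem_nhds hN, C, hC⟩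

theorem isCompact_pencil (hs : IsSemiaffine 𝓛) (p : M) : IsCompact (pencil 𝓛 p) := by
  obtain ⟨C, hC, hpC⟩ := h.exists_isCompact_pencil_subset hs (isCompact_singleton (x := p))
  exact hC.of_isClosed_subset (h.isClosed_pencil hs p) (hpC p rfl)

/-- For `q` on `K` but not on `L`, the joins of `q` with points of the compact line `L` form a
closed set. If `K` missed `L`, it would be the only line through `q` outside this set, hence
isolated in the pencil. -/
theorem inter_nonempty_of_isCompact (hs : IsSemiaffine 𝓛) {L : 𝓛} (hL : IsCompact L.1) (K : 𝓛) :
    (K.1 ∩ L.1).Nonempty := by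
  have := h.t2_lines
  obtain ⟨q, hqK⟩ := h.line_nonempty hs K
  by_cases hqL : q ∈ L.1
  · exact ⟨q, hqK, hqL⟩
  have hne : ∀ x ∈ L.1, q ≠ x := fun x hx e => hqL (e ▸ hx)
  have hC : IsClosed ((fun x => h.join q x) '' L.1) :=
    (hL.image_of_continuousOn (h.continuousOn_join_of_notMem hqL)).isClosed
  by_contra hKL
  have hKL' := Set.disjoint_iff_inter_eq_empty.2 (Set.not_nonempty_iff_eq_empty.1 hKL)
  have hsub : pencil 𝓛 q ⊆ (fun x => h.join q x) '' L.1 := by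
    refine h.pencil_subset_of_isClosed hs hC (G := K) fun G hG => ?_
    by_cases hGL : Disjoint G.1 L.1
    · exact Or.inr (Subtype.ext (hs _ L.2 q hqL _ G.2 _ K.2 hG hqK hGL hKL'))
    · obtain ⟨x, hxG, hxL⟩ := Set.not_disjoint_iff.1 hGL
      exact Or.inl ⟨x, hxL, h.join_eq (hne x hxL) hG hxG⟩
  obtain ⟨x, hxL, rfl⟩ := hsub hqK
  exact hKL ⟨x, h.right_mem_join (hne x hxL), hxL⟩

/-- If all lines through `p` met `L`, then `L` would be a continuous image of the compact pencil at
`p`. -/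
theorem exists_disjoint_of_not_isCompact (hs : IsSemiaffine 𝓛) {L : 𝓛} (hL : ¬ IsCompact L.1)
    {p : M} (hp : p ∉ L.1) : ∃ K : 𝓛, p ∈ K.1 ∧ Disjoint K.1 L.1 := by
  by_contra! hK
  have hm : ∀ K ∈ pencil 𝓛 p, K ≠ L ∧ (K.1 ∩ L.1).Nonempty := fun K hpK =>
    ⟨fun e => hp (e ▸ hpK), Set.not_disjoint_iff_nonempty_inter.1 (hK K hpK)⟩
  refine hL ?_
  have e : L.1 = (fun K => h.meet K L) '' pencil 𝓛 p := by
    refine Set.Subset.antisymm (fun x hx => ?_) ?_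
    · have hpx : p ≠ x := fun e => hp (e ▸ hx)
      exact ⟨h.join p x, h.left_mem_join hpx, h.meet_eq (h.join_ne_of_notMem hpx hp)
        (h.right_mem_join hpx) hx⟩
    · rintro _ ⟨K, hK, rfl⟩
      exact (h.mem_meet (hm K hK).2).2
  rw [e]
  exact (h.isCompact_pencil hs p).image_of_continuousOn fun K hK =>
    (h.tendsto_meet (hm K hK).1 (hm K hK).2 tendsto_id tendsto_const_nhds).mono_left
      nhdsWithin_le_nhds

/-! ### Parallelism -/

omit h in
/-- Two lines are parallel if they coincide or are disjoint. -/
def Parallel (K L : 𝓛) : Prop := K = L ∨ Disjoint K.1 L.1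

omit [TopologicalSpace M] [TopologicalSpace 𝓛] h in
theorem Parallel.symm {K L : 𝓛} (hKL : Parallel K L) : Parallel L K :=
  hKL.imp Eq.symm fun hd => hd.symm

omit [TopologicalSpace M] [TopologicalSpace 𝓛] h in
theorem Parallel.eq_of_mem {K L : 𝓛} (hKL : Parallel K L) {x : M} (hK : x ∈ K.1)
    (hL : x ∈ L.1) : K = L :=
  hKL.resolve_right (Set.not_disjoint_iff.2 ⟨x, hK, hL⟩)

omit [TopologicalSpace M] [TopologicalSpace 𝓛] h in
theorem Parallel.trans (hs : IsSemiaffine 𝓛) {J K L : 𝓛} (hJK : Parallel J K)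
    (hKL : Parallel K L) : Parallel J L := by
  rcases hJK with rfl | hJK
  · exact hKL
  rcases hKL with rfl | hKL
  · exact Or.inr hJK
  by_cases hJL : Disjoint J.1 L.1
  · exact Or.inr hJL
  obtain ⟨x, hxJ, hxL⟩ := Set.not_disjoint_iff.1 hJL
  exact Or.inl (Subtype.ext (hs _ K.2 x (Set.disjoint_left.1 hJK hxJ) _ J.2 _ L.2 hxJ hxL hJK
    hKL.symm))

theorem exists_parallel (hs : IsSemiaffine 𝓛) {L : 𝓛} (hL : ¬ IsCompact L.1) (p : M) :
    ∃ K : 𝓛, p ∈ K.1 ∧ Parallel K L := by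
  by_cases hp : p ∈ L.1
  · exact ⟨L, hp, Or.inl rfl⟩
  · obtain ⟨K, hpK, hKL⟩ := h.exists_disjoint_of_not_isCompact hs hL hp
    exact ⟨K, hpK, Or.inr hKL⟩

theorem isClosed_parallel (L : 𝓛) : IsClosed {K : 𝓛 | Parallel K L} := by
  refine isOpen_compl_iff.1 (isOpen_iff_mem_nhds.2 fun K hK => ?_)
  simp only [mem_compl_iff, mem_ofPred_eq, Parallel, not_or,
    Set.not_disjoint_iff_nonempty_inter] at hK
  filter_upwards [h.eventually_meet hK.1 hK.2 (tendsto_id (x := 𝓝 K)) tendsto_const_nhds] with J hJ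
  rw [id] at hJ
  simpa only [mem_compl_iff, mem_ofPred_eq, Parallel, not_or,
    Set.not_disjoint_iff_nonempty_inter] using hJ

/-- Every line meets the compact line `T`, and the lines meeting a compact set lie in a compact set
of lines. -/
theorem isCompact_parallel (hs : IsSemiaffine 𝓛) {T : 𝓛} (hT : IsCompact T.1) (L : 𝓛) :
    IsCompact {K : 𝓛 | Parallel K L} := by
  obtain ⟨C, hC, hTC⟩ := h.exists_isCompact_pencil_subset hs hT
  refine hC.of_isClosed_subset (h.isClosed_parallel L) fun K _ => ?_
  obtain ⟨x, hxK, hxT⟩ := h.inter_nonempty_of_isCompact hs hT K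
  exact hTC x hxT hxK

/-- If there is a compact line, then any two noncompact lines are parallel. -/
theorem parallel_of_not_isCompact (hs : IsSemiaffine 𝓛) {T : 𝓛} (hT : IsCompact T.1) {K L : 𝓛}
    (hK : ¬ IsCompact K.1) (hL : ¬ IsCompact L.1) : Parallel K L := by
  by_contra hKL
  have hm : ∀ J ∈ {J : 𝓛 | Parallel J K} ×ˢ {J : 𝓛 | Parallel J L},
      J.1 ≠ J.2 ∧ (J.1.1 ∩ J.2.1).Nonempty := by
    rintro ⟨J₁, J₂⟩ ⟨h1, h2⟩
    have h12 : ¬ Parallel J₁ J₂ := fun h12 =>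
      hKL ((Parallel.symm h1).trans hs (h12.trans hs h2))
    simpa only [Parallel, not_or, Set.not_disjoint_iff_nonempty_inter] using h12
  -- Each point is the meet of its parallels to `K` and to `L`, which are coordinates in two compact
  -- parallel classes. So the plane, and with it the closed set `K`, would be compact.
  have hc : IsCompact (univ : Set M) := by
    have e : univ = (fun J : 𝓛 × 𝓛 => h.meet J.1 J.2) ''
        ({J : 𝓛 | Parallel J K} ×ˢ {J : 𝓛 | Parallel J L}) := by
      refine (Set.eq_univ_of_forall fun x => ?_).symm
      obtain ⟨J₁, hx1, h1⟩ := h.exists_parallel hs hK x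
      obtain ⟨J₂, hx2, h2⟩ := h.exists_parallel hs hL x
      exact ⟨(J₁, J₂), ⟨h1, h2⟩, h.meet_eq (hm (J₁, J₂) ⟨h1, h2⟩).1 hx1 hx2⟩
    rw [e]
    exact ((h.isCompact_parallel hs hT K).prod (h.isCompact_parallel hs hT L)).image_of_continuousOn
      fun J hJ => (h.continuousAt_meet (hm J hJ).1 (hm J hJ).2).continuousWithinAt
  exact hK (hc.of_isClosed_subset (h.isClosed_line hs K) (subset_univ _))

end IsStablePlane

/-! ### Deleting a point of a projective plane -/

theorem Fin.not_three_of_ne {v : Fin 4 → Prop} (h012 : v 0 → v 1 → ¬ v 2)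
    (h013 : v 0 → v 1 → ¬ v 3) (h023 : v 0 → v 2 → ¬ v 3) (h123 : v 1 → v 2 → ¬ v 3)
    {i j k : Fin 4} (hij : i ≠ j) (hik : i ≠ k) (hjk : j ≠ k) : ¬ (v i ∧ v j ∧ v k) := by
  fin_cases i <;> fin_cases j <;> fin_cases k <;>
    first | exact absurd rfl hij | exact absurd rfl hik | exact absurd rfl hjk | (dsimp; tauto)

section TraceLines

variable {P : Type u} [TopologicalSpace P] {𝓚 : Set (Set P)} [TopologicalSpace 𝓚]

theorem IsStablePlane.traceLine_bijective (h : IsStablePlane P 𝓚) (hs : IsSemiaffine 𝓚) (o : P) :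
    Function.Bijective (traceLine 𝓚 o) := by
  have := h.t2_points
  constructor
  · intro K K' e
    have hmem : ∀ x ∈ K.1, x ≠ o → x ∈ K'.1 := fun x hx hxo => by
      have hx' : (⟨x, hxo⟩ : {x : P // x ≠ o}) ∈ (traceLine 𝓚 o K).1 := hx
      rw [e] at hx'
      exact hx'
    obtain ⟨a, ha, hao⟩ := h.exists_mem_line_ne hs K o
    obtain ⟨b, hb, hba, hbo⟩ :=
      (h.hasContinua_line hs ha).exists_mem_notMem (finite_singleton o)
    exact h.line_eq hba hb ha (hmem b hb hbo) (hmem a ha hao)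
  · rintro ⟨_, K, hK, rfl⟩
    exact ⟨⟨K, hK⟩, rfl⟩

/-- The lines of a plane are homeomorphic to their traces in the punctured plane. -/
noncomputable def IsStablePlane.traceHomeomorph (h : IsStablePlane P 𝓚) (hs : IsSemiaffine 𝓚)
    (o : P) : 𝓚 ≃ₜ puncturedLines 𝓚 o :=
  (Equiv.ofBijective _ (h.traceLine_bijective hs o)).toHomeomorph fun _ => isOpen_coinduced.symm

theorem IsProjectivePlane.isSemiaffine (h : IsProjectivePlane P 𝓚) : IsSemiaffine 𝓚 :=
  fun L hL _ _ K₁ hK₁ _ _ _ _ hd _ =>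
    absurd hd (Set.not_disjoint_iff_nonempty_inter.2 (h.lines_meet K₁ hK₁ L hL))

/-- Quadrangles can be chosen to avoid a given point. -/
theorem IsStablePlane.exists_quadrangle_avoiding (h : IsStablePlane P 𝓚) (hs : IsSemiaffine 𝓚)
    (o : P) : ∃ a : Fin 4 → P, (∀ i, a i ≠ o) ∧ Function.Injective a ∧
      ∀ i j k : Fin 4, i ≠ j → i ≠ k → j ≠ k → ∀ L ∈ 𝓚, ¬ (a i ∈ L ∧ a j ∈ L ∧ a k ∈ L) := by
  have := h.t2_points
  have third : ∀ {x : P} (K : 𝓚), x ∈ K.1 → ∀ {F : Set P}, F.Finite →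
      ∃ y ∈ K.1, y ≠ x ∧ y ∉ F := fun K hx _ hF =>
    (h.hasContinua_line hs hx).exists_mem_notMem hF
  obtain ⟨a, hao⟩ := h.exists_point_ne o
  obtain ⟨Lab, haL⟩ := h.exists_line_through a
  obtain ⟨b, hbL, hba, hbo⟩ := third Lab haL (finite_singleton o)
  obtain ⟨Lac, hac, haL'⟩ := h.exists_line_through_ne a Lab
  obtain ⟨c, hcL, hca, hco⟩ := third Lac haL' (finite_singleton o)
  have hcab : c ∉ Lab.1 := fun hc => hac (h.line_eq hca hcL haL' hc haL)
  have hbc : b ≠ c := fun e => hcab (e ▸ hbL)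
  have hbL' := h.left_mem_join hbc
  have hcL' := h.right_mem_join hbc
  -- The point `e` is auxiliary and may equal `o`. The fourth corner `d` is taken on the line
  -- through `a` and `e`, away from `a`, `e` and `o`.
  obtain ⟨e, heL, heb, hec⟩ := third _ hbL' (finite_singleton c)
  have hec : e ≠ c := hec
  have habc : a ∉ (h.join b c).1 := fun ha =>
    hcab (h.line_eq hba hbL' ha hbL haL ▸ hcL')
  have hae : a ≠ e := fun e' => habc (e' ▸ heL)
  have haG := h.left_mem_join hae
  have heG := h.right_mem_join hae
  obtain ⟨d, hdG, hda, hdF⟩ := third _ haG (toFinite {e, o})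
  have hde : d ≠ e := fun e' => hdF (by simp [e'])
  have hdo : d ≠ o := fun e' => hdF (by simp [e'])
  have hdab : d ∉ Lab.1 := fun hd => by
    have hG := h.line_eq hda hdG haG hd haL
    exact habc (h.line_eq heb heL hbL' (hG ▸ heG) hbL ▸ haL)
  have hdac : d ∉ Lac.1 := fun hd => by
    have hG := h.line_eq hda hdG haG hd haL'
    exact habc (h.line_eq hec heL hcL' (hG ▸ heG) hcL ▸ haL')
  have hdbc : d ∉ (h.join b c).1 := fun hd =>
    habc (h.line_eq hde hd heL hdG heG ▸ haG)
  have hdb : d ≠ b := fun e' => hdab (e' ▸ hbL)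
  have hdc : d ≠ c := fun e' => hdac (e' ▸ hcL)
  have nabc : ∀ L ∈ 𝓚, a ∈ L → b ∈ L → c ∉ L := fun L hL ha hb hc =>
    hcab (h.line_eq (K := ⟨L, hL⟩) hba hb ha hbL haL ▸ hc)
  have nabd : ∀ L ∈ 𝓚, a ∈ L → b ∈ L → d ∉ L := fun L hL ha hb hc =>
    hdab (h.line_eq (K := ⟨L, hL⟩) hba hb ha hbL haL ▸ hc)
  have nacd : ∀ L ∈ 𝓚, a ∈ L → c ∈ L → d ∉ L := fun L hL ha hb hc =>
    hdac (h.line_eq (K := ⟨L, hL⟩) hca hb ha hcL haL' ▸ hc)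
  have nbcd : ∀ L ∈ 𝓚, b ∈ L → c ∈ L → d ∉ L := fun L hL ha hb hc =>
    hdbc (h.line_eq (K := ⟨L, hL⟩) hbc ha hb hbL' hcL' ▸ hc)
  refine ⟨![a, b, c, d], ?_, ?_, ?_⟩
  · intro i
    fin_cases i <;> assumption
  · intro i j hij
    fin_cases i <;> fin_cases j <;> simp_all [eq_comm]
  · intro i j k hij hik hjk L hL
    exact Fin.not_three_of_ne (v := fun i => ![a, b, c, d] i ∈ L) (nabc L hL) (nabd L hL)
      (nacd L hL) (nbcd L hL) hij hik hjk

end TraceLines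

section Puncture

variable {M P : Type u} [TopologicalSpace M] [TopologicalSpace P] {𝓛 : Set (Set M)}
  [TopologicalSpace 𝓛] {𝓚 : Set (Set P)} [TopologicalSpace 𝓚]

/-- Two distinct lines still intersect exactly when their meet in `P` is not `o`, an open condition
because meeting is continuous. -/
theorem IsProjectivePlane.isStablePlane_puncture (h : IsProjectivePlane P 𝓚) {o : P}
    (f : M ≃ₜ {x : P // x ≠ o}) (g : 𝓛 ≃ₜ 𝓚)
    (hfg : ∀ (p : M) (L : 𝓛), p ∈ L.1 ↔ (f p).1 ∈ (g L).1) : IsStablePlane M 𝓛 := by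
  have hS := h.toIsStablePlane
  have hs := h.isSemiaffine
  have := hS.t2_points
  have := hS.t2_lines
  have := hS.locallyCompact_points
  have := hS.locallyCompact_lines
  have hO : IsOpen {x : P | x ≠ o} := isOpen_ne
  have hf : IsOpenEmbedding fun p => (f p).1 :=
    hO.isOpenEmbedding_subtypeVal.comp f.isOpenEmbedding
  have hne : ∀ {p q : M}, p ≠ q → (f p).1 ≠ (f q).1 := fun hpq => hf.injective.ne hpq
  have hmeet : ∀ K L : 𝓛, ((g K).1 ∩ (g L).1).Nonempty := fun K L =>
    h.lines_meet _ (g K).2 _ (g L).2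
  have hmem : ∀ {x : P} (hx : x ≠ o) (L : 𝓛), f.symm ⟨x, hx⟩ ∈ L.1 ↔ x ∈ (g L).1 :=
    fun hx L => by rw [hfg, f.apply_symm_apply]
  have hiff : ∀ K L : 𝓛, K ≠ L → ((K.1 ∩ L.1).Nonempty ↔ hS.meet (g K) (g L) ≠ o) := by
    intro K L hKL
    have hm := hS.mem_meet (hmeet K L)
    constructor
    · rintro ⟨x, hxK, hxL⟩
      rw [hS.meet_eq (g.injective.ne hKL) ((hfg x K).1 hxK) ((hfg x L).1 hxL)]
      exact (f x).2
    · intro ho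
      exact ⟨f.symm ⟨_, ho⟩, (hmem ho K).2 hm.1, (hmem ho L).2 hm.2⟩
  have hgc : ∀ x : 𝓛 × 𝓛, x.1 ≠ x.2 →
      ContinuousAt (fun x : 𝓛 × 𝓛 => hS.meet (g x.1) (g x.2)) x := fun x hx =>
    hS.tendsto_meet (g.injective.ne hx) (hmeet _ _)
      ((g.continuous.comp continuous_fst).tendsto x) ((g.continuous.comp continuous_snd).tendsto x)
  have hT2 : T2Space 𝓛 := g.isEmbedding.t2Space
  constructor
  · exact hf.isEmbedding.t2Space
  · exact hT2
  · exact hf.locallyCompactSpace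
  · exact g.isOpenEmbedding.locallyCompactSpace
  · obtain ⟨p, hp⟩ := hS.exists_point_ne o
    obtain ⟨K, hpK⟩ := hS.exists_line_through p
    -- A continuum chosen inside the complement of `o` pulls back to a nondegenerate connected set
    -- in `M`.
    obtain ⟨S, hSK, -, hSp, hpS, q, hqS, hqp⟩ := hS.hasContinua_line hs hpK _ (hO.mem_nhds hp)
    have := hf.isEmbedding.t2Space
    have hSo : ∀ x ∈ S, x ≠ o := fun x hx => (hSK hx).2
    have hpre := hSp.preimage_of_isOpenMap hf.injective hf.isOpenMap fun x hx =>
      ⟨f.symm ⟨x, hSo x hx⟩, by simp⟩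
    refine hpre.smallInductiveDimension_pos (x := f.symm ⟨p, hp⟩) (y := f.symm ⟨q, hSo q hqS⟩)
      (by simpa using hpS) (by simpa using hqS) fun e => hqp ?_
    exact (congrArg Subtype.val (f.symm.injective e)).symm
  · exact g.symm.smallInductiveDimension_pos hS.dim_lines_pos
  · intro p q hpq
    refine ⟨g.symm (hS.join (f p).1 (f q).1), ?_, fun L hL => ?_⟩
    · simp only [hfg, g.apply_symm_apply]
      exact hS.mem_join (hne hpq)
    · rw [hS.join_eq (hne hpq) ((hfg _ _).1 hL.1) ((hfg _ _).1 hL.2), g.symm_apply_apply]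
  · refine ⟨fun x => g.symm (hS.join (f x.1.1).1 (f x.1.2).1), fun x => ?_, ?_⟩
    · simp only [hfg, g.apply_symm_apply]
      exact hS.mem_join (hne x.2)
    · refine g.symm.continuous.comp (continuous_iff_continuousAt.2 fun x => ?_)
      exact hS.tendsto_join (hne x.2)
        ((hf.continuous.comp (continuous_fst.comp continuous_subtype_val)).tendsto x)
        ((hf.continuous.comp (continuous_snd.comp continuous_subtype_val)).tendsto x)
  · refine isOpen_iff_mem_nhds.2 fun x hx => ?_
    have e1 : ∀ᶠ y : 𝓛 × 𝓛 in 𝓝 x, y.1 ≠ y.2 :=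
      (isOpen_ne_fun continuous_fst continuous_snd).mem_nhds hx.1
    filter_upwards [e1, (hgc x hx.1).eventually (hO.mem_nhds ((hiff _ _ hx.1).1 hx.2))] with y h1 h2
    exact ⟨h1, (hiff _ _ h1).2 h2⟩
  · refine ⟨fun x => f.symm ⟨hS.meet (g x.1.1) (g x.1.2), (hiff _ _ x.2.1).1 x.2.2⟩,
      fun x => ?_, ?_⟩
    · simp only [hmem]
      exact hS.mem_meet (hmeet _ _)
    · refine f.symm.continuous.comp (Continuous.subtype_mk ?_ _)
      exact continuous_iff_continuousAt.2 fun x =>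
        (hgc x.1 x.2.1).comp continuous_subtype_val.continuousAt
  · obtain ⟨a, hao, ha, hnc⟩ := hS.exists_quadrangle_avoiding hs o
    refine ⟨fun i => f.symm ⟨a i, hao i⟩, fun i j hij => ha ?_, ?_⟩
    · exact congrArg Subtype.val (f.symm.injective hij)
    · intro i j k hij hik hjk L hL hijk
      have hm := fun i => hmem (hao i) ⟨L, hL⟩
      exact hnc i j k hij hik hjk _ (g ⟨L, hL⟩).2
        ⟨(hm i).1 hijk.1, (hm j).1 hijk.2.1, (hm k).1 hijk.2.2⟩

theorem IsProjectivePlane.isSemiaffine_puncture (h : IsProjectivePlane P 𝓚) {o : P}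
    (f : M ≃ₜ {x : P // x ≠ o}) (g : 𝓛 ≃ₜ 𝓚)
    (hfg : ∀ (p : M) (L : 𝓛), p ∈ L.1 ↔ (f p).1 ∈ (g L).1) : IsSemiaffine 𝓛 := by
  intro L hL p _ K₁ hK₁ K₂ hK₂ h1 h2 hd1 hd2
  have ho : ∀ K : 𝓛, Disjoint K.1 L → o ∈ (g K).1 := by
    intro K hd
    obtain ⟨x, hxK, hxL⟩ := h.lines_meet _ (g K).2 _ (g ⟨L, hL⟩).2
    by_contra hoK
    have hxo : x ≠ o := fun e => hoK (e ▸ hxK)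
    have hyK : f.symm ⟨x, hxo⟩ ∈ K.1 := by rwa [hfg, f.apply_symm_apply]
    have hyL : f.symm ⟨x, hxo⟩ ∈ L := (hfg _ ⟨L, hL⟩).2 (by rwa [f.apply_symm_apply])
    exact Set.disjoint_left.1 hd hyK hyL
  have e := h.toIsStablePlane.line_eq (f p).2 ((hfg p ⟨K₁, hK₁⟩).1 h1) (ho ⟨K₁, hK₁⟩ hd1)
    ((hfg p ⟨K₂, hK₂⟩).1 h2) (ho ⟨K₂, hK₂⟩ hd2)
  exact congrArg Subtype.val (g.injective e)

theorem IsPuncturedProjectivePlane.isStablePlane_and_isSemiaffine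
    (h : IsPuncturedProjectivePlane M 𝓛) : IsStablePlane M 𝓛 ∧ IsSemiaffine 𝓛 := by
  obtain ⟨P, _, 𝓚, _, o, hP, f, g, hfg⟩ := h
  let t := hP.toIsStablePlane.traceHomeomorph hP.isSemiaffine o
  have hfg' : ∀ (p : M) (L : 𝓛), p ∈ L.1 ↔ (f p).1 ∈ (g.trans t.symm L).1 := by
    intro p L
    rw [hfg]
    obtain ⟨K, hK⟩ := t.surjective (g L)
    rw [Homeomorph.trans_apply, ← hK, t.symm_apply_apply]
    rfl
  exact ⟨hP.isStablePlane_puncture f _ hfg', hP.isSemiaffine_puncture f _ hfg'⟩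

end Puncture

/-! ### The one-point extension -/

section Extend

variable {M : Type u} [TopologicalSpace M] {𝓛 : Set (Set M)}

/-- The extension of a line to the one-point compactification: the point at infinity is added to
the noncompact lines. -/
def extendLine (L : 𝓛) : Set (OnePoint M) :=
  {x | (∃ p ∈ L.1, (p : OnePoint M) = x) ∨ (x = OnePoint.infty ∧ ¬ IsCompact L.1)}

theorem coe_mem_extendLine {L : 𝓛} {p : M} : (p : OnePoint M) ∈ extendLine L ↔ p ∈ L.1 := by
  simp [extendLine]

theorem infty_mem_extendLine {L : 𝓛} : OnePoint.infty ∈ extendLine L ↔ ¬ IsCompact L.1 := by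
  simp [extendLine]

theorem extendLine_injective : Function.Injective (extendLine : 𝓛 → Set (OnePoint M)) := by
  intro K L e
  ext p
  rw [← coe_mem_extendLine, e, coe_mem_extendLine]

variable (𝓛) in
/-- The lines of the one-point extension of a plane. -/
def extendedLines : Set (Set (OnePoint M)) := range (extendLine : 𝓛 → Set (OnePoint M))

variable (𝓛) in
/-- The correspondence between lines and extended lines. -/
noncomputable def extendEquiv : 𝓛 ≃ extendedLines 𝓛 := Equiv.ofInjective _ extendLine_injective

variable [TopologicalSpace 𝓛]

noncomputable instance extendedLinesTopology : TopologicalSpace (extendedLines 𝓛) :=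
  TopologicalSpace.coinduced (extendEquiv 𝓛) inferInstance

variable (𝓛) in
/-- The homeomorphism between lines and extended lines. -/
noncomputable def extendHomeomorph : 𝓛 ≃ₜ extendedLines 𝓛 :=
  (extendEquiv 𝓛).toHomeomorph fun _ => isOpen_coinduced.symm

namespace IsStablePlane

variable (h : IsStablePlane M 𝓛) (hs : IsSemiaffine 𝓛)
include h hs

/-- Lines close to a compact line `L` lie in any given compact neighbourhood of `L`. -/
theorem eventually_subset_of_isCompact {L : 𝓛} {Q : Set M} (hQ : IsCompact Q)
    (hLQ : L.1 ⊆ interior Q) : ∀ᶠ K : 𝓛 in 𝓝 L, K.1 ⊆ Q := by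
  have := h.t2_points
  obtain ⟨z, hzL⟩ := h.line_nonempty hs L
  obtain ⟨J, hJL, hzJ⟩ := h.exists_line_through_ne z L
  have hJz : h.meet J L = z := h.meet_eq hJL hzJ hzL
  have hJm : (J.1 ∩ L.1).Nonempty := ⟨z, hzJ, hzL⟩
  -- Lines near `L` still meet `J` inside `Q` and, incidence being closed, still avoid the compact
  -- frontier of `Q`.
  have e1 := h.eventually_meet (f := 𝓝 L) hJL hJm tendsto_const_nhds tendsto_id
  have e2 := (h.tendsto_meet (f := 𝓝 L) hJL hJm tendsto_const_nhds tendsto_id).eventually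
    (isOpen_interior.mem_nhds (hJz ▸ hLQ hzL : h.meet J L ∈ interior Q))
  have hF : IsCompact (frontier Q) :=
    hQ.of_isClosed_subset isClosed_frontier hQ.isClosed.frontier_subset
  have e3 : ∀ᶠ K : 𝓛 in 𝓝 L, ∀ x ∈ frontier Q, x ∉ K.1 := by
    refine hF.eventually_forall_of_forall_eventually fun x hx => ?_
    have hc : IsClosed {z : 𝓛 × M | z.2 ∈ z.1.1} :=
      (h.isClosed_incidence hs).preimage continuous_swap
    exact hc.isOpen_compl.mem_nhds fun hxL => hx.2 (hLQ hxL)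
  filter_upwards [e1, e2, e3] with K h1 h2 h3
  exact (h.line_subset_of_disjoint_frontier hs hQ
    ⟨_, (h.mem_meet h1.2).2, interior_subset h2⟩
    (Set.disjoint_right.2 h3)).trans interior_subset

/-- The critical case is infinity and a compact line `L`: nearby lines stay in a compact
neighbourhood of `L`, while points near infinity stay outside it. -/
theorem isClosed_extendLine_incidence :
    IsClosed {x : OnePoint M × 𝓛 | x.1 ∈ extendLine x.2} := by
  have := h.t2_points
  have := h.locallyCompact_points
  refine isOpen_compl_iff.1 (isOpen_iff_mem_nhds.2 ?_)
  rintro ⟨x, L⟩ hx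
  induction x using OnePoint.rec with
  | infty =>
    have hL : IsCompact L.1 := not_not.1 fun hL => hx (infty_mem_extendLine.2 hL)
    obtain ⟨Q, hQ, hLQ⟩ := exists_compact_superset hL
    have e1 : ∀ᶠ y in 𝓝 (OnePoint.infty : OnePoint M), y ∉ ((↑) '' Q : Set (OnePoint M)) :=
      (OnePoint.isOpen_compl_image_coe.2 ⟨hQ.isClosed, hQ⟩).mem_nhds (by simp)
    have e2 := h.eventually_subset_of_isCompact hs hQ hLQ
    rw [nhds_prod_eq]
    filter_upwards [e1.prod_mk e2]
    rintro ⟨y, K⟩ ⟨hy, hK⟩ hyK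
    induction y using OnePoint.rec with
    | infty => exact infty_mem_extendLine.1 hyK (hQ.of_isClosed_subset (h.isClosed_line hs K) hK)
    | coe p => exact hy ⟨p, hK (coe_mem_extendLine.1 hyK), rfl⟩
  | coe p =>
    have e : ∀ᶠ z : M × 𝓛 in 𝓝 (p, L), z.1 ∉ z.2.1 :=
      (h.isClosed_incidence hs).isOpen_compl.mem_nhds fun hp => hx (coe_mem_extendLine.2 hp)
    have hmap : 𝓝 ((p : OnePoint M), L) = map (Prod.map (↑) id) (𝓝 (p, L)) := by
      rw [nhds_prod_eq, nhds_prod_eq, OnePoint.nhds_coe_eq, ← map_id (f := 𝓝 L), prod_map_map_eq, map_id]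
      rfl
    rw [hmap]
    exact e.mono fun z hz hzL => hz (coe_mem_extendLine.1 hzL)

theorem mem_extendLine_of_mapClusterPt {α : Type*} {l : Filter α} {u : α → OnePoint M}
    {v : α → 𝓛} {x : OnePoint M} {L : 𝓛} (hu : Tendsto u l (𝓝 x)) (hv : MapClusterPt L l v)
    (huv : ∀ᶠ a in l, u a ∈ extendLine (v a)) : x ∈ extendLine L := by
  obtain ⟨U, hUl, hU⟩ := mapClusterPt_iff_ultrafilter.1 hv
  exact (h.isClosed_extendLine_incidence hs).mem_of_tendsto ((hu.mono_left hUl).prodMk_nhds hU)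
    (hUl huv)

theorem mem_extendLine_of_mapClusterPt' {α : Type*} {l : Filter α} {u : α → OnePoint M}
    {v : α → 𝓛} {x : OnePoint M} {L : 𝓛} (hu : MapClusterPt x l u) (hv : Tendsto v l (𝓝 L))
    (huv : ∀ᶠ a in l, u a ∈ extendLine (v a)) : x ∈ extendLine L := by
  obtain ⟨U, hUl, hU⟩ := mapClusterPt_iff_ultrafilter.1 hu
  exact (h.isClosed_extendLine_incidence hs).mem_of_tendsto (hU.prodMk_nhds (hv.mono_left hUl))
    (hUl huv)

variable {T N : 𝓛} (hT : IsCompact T.1) (hN : ¬ IsCompact N.1)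
include hT

theorem extendLine_eq {x y : OnePoint M} (hxy : x ≠ y) {K L : 𝓛} (hxK : x ∈ extendLine K)
    (hyK : y ∈ extendLine K) (hxL : x ∈ extendLine L) (hyL : y ∈ extendLine L) : K = L := by
  have key : ∀ p : M, p ∈ K.1 → p ∈ L.1 → OnePoint.infty ∈ extendLine K →
      OnePoint.infty ∈ extendLine L → K = L := fun p hpK hpL hK hL =>
    (h.parallel_of_not_isCompact hs hT (infty_mem_extendLine.1 hK)
      (infty_mem_extendLine.1 hL)).eq_of_mem hpK hpL
  induction x using OnePoint.rec with
  | infty =>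
    induction y using OnePoint.rec with
    | infty => exact absurd rfl hxy
    | coe q => exact key q (coe_mem_extendLine.1 hyK) (coe_mem_extendLine.1 hyL) hxK hxL
  | coe p =>
    induction y using OnePoint.rec with
    | infty => exact key p (coe_mem_extendLine.1 hxK) (coe_mem_extendLine.1 hxL) hyK hyL
    | coe q =>
      exact h.line_eq (fun e => hxy (congrArg _ e)) (coe_mem_extendLine.1 hxK)
        (coe_mem_extendLine.1 hyK) (coe_mem_extendLine.1 hxL) (coe_mem_extendLine.1 hyL)

omit hT in
theorem extendLine_inter_nonempty (K L : 𝓛) : (extendLine K ∩ extendLine L).Nonempty := by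
  have key : ∀ K L : 𝓛, IsCompact L.1 → (extendLine K ∩ extendLine L).Nonempty := fun K L hL =>
    let ⟨p, hpK, hpL⟩ := h.inter_nonempty_of_isCompact hs hL K
    ⟨p, coe_mem_extendLine.2 hpK, coe_mem_extendLine.2 hpL⟩
  by_cases hL : IsCompact L.1
  · exact key K L hL
  by_cases hK : IsCompact K.1
  · exact Set.inter_comm _ _ ▸ key L K hK
  exact ⟨OnePoint.infty, infty_mem_extendLine.2 hK, infty_mem_extendLine.2 hL⟩

include hN

omit hT in
-- Infinity is joined to `p` by the parallel to `N` through `p`. This line is noncompact: a compact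
-- one would meet `N` and so coincide with it.
theorem exists_extendLine {x y : OnePoint M} (hxy : x ≠ y) :
    ∃ L : 𝓛, x ∈ extendLine L ∧ y ∈ extendLine L := by
  have key : ∀ p : M, ∃ L : 𝓛, OnePoint.infty ∈ extendLine L ∧ (p : OnePoint M) ∈ extendLine L := by
    intro p
    obtain ⟨K, hpK, hKN⟩ := h.exists_parallel hs hN p
    refine ⟨K, infty_mem_extendLine.2 fun hK => ?_, coe_mem_extendLine.2 hpK⟩
    obtain ⟨x, hxN, hxK⟩ := h.inter_nonempty_of_isCompact hs hK N
    exact hN (hKN.eq_of_mem hxK hxN ▸ hK)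
  induction x using OnePoint.rec with
  | infty =>
    induction y using OnePoint.rec with
    | infty => exact absurd rfl hxy
    | coe q => exact key q
  | coe p =>
    induction y using OnePoint.rec with
    | infty => exact (key p).imp fun _ => And.symm
    | coe q =>
      have hpq : p ≠ q := fun e => hxy (congrArg _ e)
      exact ⟨h.join p q, coe_mem_extendLine.2 (h.left_mem_join hpq),
        coe_mem_extendLine.2 (h.right_mem_join hpq)⟩

omit hN in
/-- Joining is continuous in the one-point extension. -/
theorem continuous_extendLine_join {J : {x : OnePoint M × OnePoint M // x.1 ≠ x.2} → 𝓛}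
    (hJ : ∀ x, x.1.1 ∈ extendLine (J x) ∧ x.1.2 ∈ extendLine (J x)) : Continuous J := by
  refine continuous_iff_continuousAt.2 fun x => ?_
  have t1 : Tendsto (fun y : {x : OnePoint M × OnePoint M // x.1 ≠ x.2} => y.1.1) (𝓝 x)
      (𝓝 x.1.1) := (continuous_fst.comp continuous_subtype_val).tendsto x
  have t2 : Tendsto (fun y : {x : OnePoint M × OnePoint M // x.1 ≠ x.2} => y.1.2) (𝓝 x)
      (𝓝 x.1.2) := (continuous_snd.comp continuous_subtype_val).tendsto x
  have hloc : ∀ (u : {x : OnePoint M × OnePoint M // x.1 ≠ x.2} → OnePoint M),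
      Tendsto u (𝓝 x) (𝓝 (u x)) → (∀ y, u y ∈ extendLine (J y)) → u x ≠ OnePoint.infty →
      ∃ C : Set 𝓛, IsCompact C ∧ ∀ᶠ y in 𝓝 x, J y ∈ C := by
    intro u hu huJ hux
    obtain ⟨p, hp⟩ := OnePoint.ne_infty_iff_exists.1 hux
    obtain ⟨V, hV, C, hC, hVC⟩ := h.exists_isCompact_pencil_subset_nhds hs p
    refine ⟨C, hC, ?_⟩
    rw [← hp, OnePoint.nhds_coe_eq] at hu
    filter_upwards [hu (image_mem_map hV)] with y hy
    obtain ⟨q, hq, hqy⟩ := hy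
    refine hVC q hq (coe_mem_extendLine.1 ?_)
    rw [hqy]
    exact huJ y
  obtain ⟨C, hC, hCJ⟩ : ∃ C : Set 𝓛, IsCompact C ∧ ∀ᶠ y in 𝓝 x, J y ∈ C := by
    by_cases hx : x.1.1 = OnePoint.infty
    · exact hloc (fun y => y.1.2) t2 (fun y => (hJ y).2) fun e => x.2 (hx.trans e.symm)
    · exact hloc (fun y => y.1.1) t1 (fun y => (hJ y).1) hx
  -- One of the two points is finite, so nearby joins lie in a compact set of lines; any cluster
  -- line contains both points and is therefore their join.
  refine hC.tendsto_nhds_of_unique_mapClusterPt hCJ fun L _ hL => ?_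
  exact h.extendLine_eq hs hT x.2
    (h.mem_extendLine_of_mapClusterPt hs t1 hL (Eventually.of_forall fun y => (hJ y).1))
    (h.mem_extendLine_of_mapClusterPt hs t2 hL (Eventually.of_forall fun y => (hJ y).2))
    (hJ x).1 (hJ x).2

theorem isProjectivePlane_extend : IsProjectivePlane (OnePoint M) (extendedLines 𝓛) := by
  have := h.t2_points
  have := h.t2_lines
  have := h.locallyCompact_points
  have := h.locallyCompact_lines
  let e := extendHomeomorph 𝓛
  have he : ∀ K : extendedLines 𝓛, K.1 = extendLine (e.symm K) := fun K => by
    conv_lhs => rw [← e.apply_symm_apply K]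
    rfl
  have hmeet : ∀ K ∈ extendedLines 𝓛, ∀ L ∈ extendedLines 𝓛, (K ∩ L).Nonempty := by
    rintro _ ⟨K, rfl⟩ _ ⟨L, rfl⟩
    exact h.extendLine_inter_nonempty hs K L
  have hT2 : T2Space (extendedLines 𝓛) := e.symm.isEmbedding.t2Space
  refine { t2_points := inferInstance
           t2_lines := hT2
           locallyCompact_points := inferInstance
           locallyCompact_lines := e.symm.isOpenEmbedding.locallyCompactSpace
           dim_points_pos := ?_
           dim_lines_pos := e.smallInductiveDimension_pos h.dim_lines_pos
           existsUnique_join := ?_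
           continuous_join := ?_
           isOpen_intersecting := ?_
           continuous_meet := ?_
           exists_quadrangle := ?_
           lines_meet := hmeet }
  · obtain ⟨p, hp⟩ := h.line_nonempty hs T
    obtain ⟨S, -, -, hSp, hpS, q, hqS, hqp⟩ := h.hasContinua_line hs hp univ univ_mem
    exact (hSp.image _ OnePoint.continuous_coe.continuousOn).smallInductiveDimension_pos
      (mem_image_of_mem _ hqS) (mem_image_of_mem _ hpS) (OnePoint.coe_injective.ne hqp)
  · intro x y hxy
    obtain ⟨L, hx, hy⟩ := h.exists_extendLine hs hN hxy
    refine ⟨e L, ⟨hx, hy⟩, fun K hK => ?_⟩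
    simp only [he K] at hK
    rw [h.extendLine_eq hs hT hxy hx hy hK.1 hK.2, e.apply_symm_apply]
  · choose J hJ using fun x : {x : OnePoint M × OnePoint M // x.1 ≠ x.2} =>
      h.exists_extendLine hs hN x.2
    exact ⟨fun x => e (J x), hJ, e.continuous.comp (h.continuous_extendLine_join hs hT hJ)⟩
  · have ho : IsOpen {x : extendedLines 𝓛 × extendedLines 𝓛 | x.1 ≠ x.2} :=
      isOpen_ne_fun continuous_fst continuous_snd
    have hiff : {x : extendedLines 𝓛 × extendedLines 𝓛 |
        x.1 ≠ x.2 ∧ ((x.1 : Set (OnePoint M)) ∩ (x.2 : Set (OnePoint M))).Nonempty} =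
        {x | x.1 ≠ x.2} := Set.ext fun x => and_iff_left (hmeet _ x.1.2 _ x.2.2)
    rwa [hiff]
  · choose m hm using fun x : {x : extendedLines 𝓛 × extendedLines 𝓛 //
      x.1 ≠ x.2 ∧ ((x.1 : Set (OnePoint M)) ∩ (x.2 : Set (OnePoint M))).Nonempty} => x.2.2
    refine ⟨m, hm, continuous_iff_continuousAt.2 fun x => ?_⟩
    -- In the compact extended plane, convergence only needs uniqueness of cluster points, and these
    -- lie on both limit lines.
    refine isCompact_univ.tendsto_nhds_of_unique_mapClusterPt
      (Eventually.of_forall fun _ => mem_univ _) fun y _ hy => ?_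
    have h1 : y ∈ extendLine (e.symm x.1.1) := h.mem_extendLine_of_mapClusterPt' hs hy
      ((e.symm.continuous.comp (continuous_fst.comp continuous_subtype_val)).tendsto x)
      (Eventually.of_forall fun z => he z.1.1 ▸ (hm z).1)
    have h2 : y ∈ extendLine (e.symm x.1.2) := h.mem_extendLine_of_mapClusterPt' hs hy
      ((e.symm.continuous.comp (continuous_snd.comp continuous_subtype_val)).tendsto x)
      (Eventually.of_forall fun z => he z.1.2 ▸ (hm z).2)
    by_contra hne
    exact x.2.1 (e.symm.injective (h.extendLine_eq hs hT hne h1 (he x.1.1 ▸ (hm x).1) h2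
      (he x.1.2 ▸ (hm x).2)))
  · obtain ⟨a, ha, hnc⟩ := h.exists_quadrangle
    refine ⟨fun i => (a i : OnePoint M), fun i j hij => ha (OnePoint.coe_injective hij), ?_⟩
    rintro i j k hij hik hjk _ ⟨L, rfl⟩ hL
    exact hnc i j k hij hik hjk L L.2 ⟨coe_mem_extendLine.1 hL.1, coe_mem_extendLine.1 hL.2.1,
      coe_mem_extendLine.1 hL.2.2⟩

theorem isPuncturedProjectivePlane : IsPuncturedProjectivePlane M 𝓛 := by
  have hP := h.isProjectivePlane_extend hs hT hN
  let f₀ : M ≃ {x : OnePoint M // x ≠ OnePoint.infty} :=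
    Equiv.ofBijective (fun p => ⟨p, OnePoint.coe_ne_infty p⟩)
      ⟨fun p q hpq => OnePoint.coe_injective (congrArg Subtype.val hpq), fun ⟨x, hx⟩ =>
        let ⟨p, hp⟩ := OnePoint.ne_infty_iff_exists.1 hx
        ⟨p, Subtype.ext hp⟩⟩
  have hf₀ : IsInducing f₀ := IsInducing.of_comp
    (OnePoint.continuous_coe.subtype_mk _) continuous_subtype_val
    OnePoint.isOpenEmbedding_coe.isInducing
  refine ⟨OnePoint M, inferInstance, extendedLines 𝓛, inferInstance, OnePoint.infty, hP,
    f₀.toHomeomorphOfIsInducing hf₀, (extendHomeomorph 𝓛).trans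
      (hP.toIsStablePlane.traceHomeomorph hP.isSemiaffine OnePoint.infty), fun p L => ?_⟩
  exact coe_mem_extendLine.symm

end IsStablePlane

end Extend

/-! ### The classification -/

theorem theorem2p6 (M : Type u) [TopologicalSpace M] (𝓛 : Set (Set M)) [TopologicalSpace 𝓛] :
    (IsStablePlane M 𝓛 ∧ IsSemiaffine 𝓛) ↔
      (IsAffinePlane M 𝓛 ∨ IsProjectivePlane M 𝓛 ∨ IsPuncturedProjectivePlane M 𝓛) := by
  constructor
  · rintro ⟨h, hs⟩
    by_cases hc : ∃ T : 𝓛, IsCompact T.1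
    · obtain ⟨T, hT⟩ := hc
      by_cases hn : ∃ N : 𝓛, ¬ IsCompact N.1
      · obtain ⟨N, hN⟩ := hn
        exact Or.inr (Or.inr (h.isPuncturedProjectivePlane hs hT hN))
      · push Not at hn
        exact Or.inr (Or.inl ⟨h, fun K hK L hL =>
          h.inter_nonempty_of_isCompact hs (L := ⟨L, hL⟩) (hn _) ⟨K, hK⟩⟩)
    · push Not at hc
      refine Or.inl ⟨h, fun L hL p hp => ?_⟩
      obtain ⟨K, hpK, hKL⟩ := h.exists_disjoint_of_not_isCompact hs (hc ⟨L, hL⟩) hp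
      exact ⟨K, ⟨K.2, hpK, hKL⟩, fun K' hK' =>
        hs L hL p hp K' hK'.1 K K.2 hK'.2.1 hpK hK'.2.2 hKL⟩
  · rintro (⟨h, hpar⟩ | h | h)
    · refine ⟨h, fun L hL p hp K₁ h₁ K₂ h₂ hp₁ hp₂ hd₁ hd₂ => ?_⟩
      exact (hpar L hL p hp).unique ⟨h₁, hp₁, hd₁⟩ ⟨h₂, hp₂, hd₂⟩
    · exact ⟨h.toIsStablePlane, h.isSemiaffine⟩
    · exact h.isStablePlane_and_isSemiaffine
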